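/- **Setting.** Let $n,m\ge 1$. A data set $\mathcal D=(\mathcal D^{lrn},\mathcal D^{cal})$ consists of a learning set $\mathcal D^{lrn}$ and of calibration data $\mathcal D^{cal}=(X_{i,j},Y_{i,j})_{1\le i\le n,\,1\le j\le m}$ with values in $\mathcal X\times\mathcal Y$, agent $j$ holding the $n$ points $(X_{i,j},Y_{i,j})_{1\le i\le n}$. The calibration data are i.i.d. with the same distribution as a test point $(X,Y)$, $\mathcal D^{lrn}$ is independent of $\mathcal D^{cal}$, and $(X,Y)$ is independent of $\mathcal D$. A (measurable) score function $s:\mathcal X\times\mathcal Y\to\mathbb R$ is learned from $\mathcal D^{lrn}$ only; put $S_{i,j}=s(X_{i,j},Y_{i,j})$ and $S=s(X,Y)$. For $(\ell,k)\in\{1,\dots,n\}\times\{1,\dots,m\}$ let $S_{(\ell,k)}$ be the $k$-th smallest of the $m$ numbers obtained by taking, for each agent $j$, the $\ell$-th smallest of $S_{1,j},\dots,S_{n,j}$. Let $\widehat C_{\ell,k}(x)=\{y\in\mathcal Y: s(x,y)\le S_{(\ell,k)}\}$ and $\alpha_{\ell,k}(\mathcal D)=\mathbb P\bigl(Y\notin\widehat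 C_{\ell,k}(X)\,\big|\,\mathcal D\bigr)$. **Algorithms.** For $1\le r\le N$ let $F_{U_{(r:N)}}$ and $F_{U_{(r:N)}}^{-1}$ be the cdf and the quantile function of the $\mathrm{Beta}(r,N-r+1)$ distribution, and $F_{U_{(\ell:n,k:m)}}^{-1}=F_{U_{(\ell:n)}}^{-1}\circ F_{U_{(k:m)}}^{-1}$. Let $\alpha,\beta\in(0,1)$. * QQC chooses a pair $(\ell,k)$ that minimizes $F_{U_{(\ell:n,k:m)}}^{-1}(1-\beta)$ among the pairs $(\ell,k)\in\{1,\dots,n\}\times\{1,\dots,m\}$ such that $F_{U_{(\ell:n,k:m)}}^{-1}(\beta)\ge 1-\alpha$. * QQC-Fast: with $\tilde k(\ell)=\Bigl\lceil (m+1)\Bigl(F_{U_{(\ell:n)}}(1-\alpha)+\sqrt{\tfrac{\log(1/\beta)}{2(m+2)}}\Bigr)\Bigr\rceil$, it chooses an $\ell$ that minimizes $F_{U_{(\ell:n,\tilde k(\ell):m)}}^{-1}(1-\beta)$ among the $\ell\in\{1,\dots,n\}$ such that $\tilde k(\ell)\le m$, and outputs the pair $(\ell,\tilde k(\ell))$.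 **Theorem.** There are functions $n_0',m_0':(0,1)\to\{1,2,\dots\}$ such that the following holds for all $\alpha,\beta\in(0,1)$, all $n\ge n_0'(\alpha)$ and all $m\ge m_0'(\beta)$. The sets over which QQC and QQC-Fast minimize are non-empty, so that both algorithms choose a pair. Moreover, in every setting as above in which the scores $S_{i,j}$ ($1\le i\le n$, $1\le j\le m$) and $S$ are almost surely distinct, every pair $(\ell,k)$ chosen by QQC or by QQC-Fast (whatever the rule for breaking ties) satisfies, almost surely, $$\mathbb P\left(1-\alpha_{\ell,k}(\mathcal D)\le 1-\alpha+\frac{\Delta(\beta)}{\sqrt{(m+2)(n+2)}}\;\middle|\;\mathcal D^{lrn}\right)\ge 1-\beta,\qquad \Delta(\beta)=12\max\bigl\{2\sqrt{\log(1/\beta)},\,1\bigr\}.$$ In particular the same bound holds for the unconditional probability. -/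

import Mathlib

open MeasureTheory ProbabilityTheory Set

noncomputable section

/-- The cumulative distribution function `F_{U_(r:N)}` of the distribution `Beta(r, N - r + 1)`,
i.e. of the `r`-th order statistic of `N` independent standard uniform variables. -/
def orderStatCDF (r N : ℕ) (t : ℝ) : ℝ :=
  (betaMeasure (r : ℝ) ((N : ℝ) - r + 1)).real (Iic t)

/-- The quantile function (generalized inverse) of `Beta(r, N - r + 1)`,
`F⁻¹(p) = inf {t | p ≤ F t}` for `p` in `(0, 1)`. -/
def orderStatQuantile (r N : ℕ) (p : ℝ) : ℝ :=
  sInf {t : ℝ | p ≤ orderStatCDF r N t}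

/-- The Beta-Beta quantile function `F⁻¹_{U_(ℓ:n, k:m)} = F⁻¹_{U_(ℓ:n)} ∘ F⁻¹_{U_(k:m)}`. -/
def betaBetaQuantile (n m ℓ k : ℕ) (p : ℝ) : ℝ :=
  orderStatQuantile ℓ n (orderStatQuantile k m p)

/-- Pairs `(ℓ, k)` in `{1, …, n} × {1, …, m}` with `F⁻¹_{U_(ℓ:n, k:m)}(β) ≥ 1 - α`. -/
def qqcFeasible (n m : ℕ) (α β : ℝ) : Set (ℕ × ℕ) :=
  {p | p.1 ∈ Icc 1 n ∧ p.2 ∈ Icc 1 m ∧ 1 - α ≤ betaBetaQuantile n m p.1 p.2 β}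

/-- `p = (ℓ, k)` is a pair that QQC may choose: it minimizes `F⁻¹_{U_(ℓ:n, k:m)}(1 - β)` over
the feasible pairs (with an arbitrary rule for breaking ties). -/
def IsQQCChoice (n m : ℕ) (α β : ℝ) (p : ℕ × ℕ) : Prop :=
  p ∈ qqcFeasible n m α β ∧
    ∀ q ∈ qqcFeasible n m α β,
      betaBetaQuantile n m p.1 p.2 (1 - β) ≤ betaBetaQuantile n m q.1 q.2 (1 - β)

/-- The order
`⌈(m + 1) (F_{U_(ℓ:n)}(1 - α) + √(log (1/β) / (2 (m + 2))))⌉` used by QQC-Fast.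
The number inside is nonnegative for `β` in `(0, 1)`. -/
def condOrder (m n ℓ : ℕ) (α β : ℝ) : ℕ :=
  ⌈((m : ℝ) + 1) *
    (orderStatCDF ℓ n (1 - α) + √(Real.log (1 / β) / (2 * ((m : ℝ) + 2))))⌉₊

/-- Orders `ℓ` in `{1, …, n}` whose associated `k` is at most `m`. -/
def qqcFastFeasible (n m : ℕ) (α β : ℝ) : Set ℕ :=
  {ℓ | ℓ ∈ Icc 1 n ∧ condOrder m n ℓ α β ≤ m}

/-- `p = (ℓ, k)` is a pair that QQC-Fast may choose: `k` is the order associated with `ℓ`, and `ℓ`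
minimizes the Beta-Beta `(1 - β)`-quantile of such pairs (with an arbitrary rule for ties). -/
def IsQQCFastChoice (n m : ℕ) (α β : ℝ) (p : ℕ × ℕ) : Prop :=
  p.2 = condOrder m n p.1 α β ∧ p.1 ∈ qqcFastFeasible n m α β ∧
    ∀ ℓ ∈ qqcFastFeasible n m α β,
      betaBetaQuantile n m p.1 (condOrder m n p.1 α β) (1 - β) ≤
        betaBetaQuantile n m ℓ (condOrder m n ℓ α β) (1 - β)

/-- The sample quantile: for `r ≥ 1`, the `r`-th smallest of the `N` values of `v` if `r ≤ N`,
and `+∞` otherwise. -/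
def sampleQuantile {N : ℕ} (r : ℕ) (v : Fin N → EReal) : EReal :=
  if h : r - 1 < N then v (Tuple.sort v ⟨r - 1, h⟩) else ⊤

/-- The quantile-of-quantiles `S_(ℓ, k)` of the scores `S j i`, agent `j` holding `S j`. -/
def qqEstimator {m n : ℕ} (ℓ k : ℕ) (S : Fin m → Fin n → ℝ) : EReal :=
  sampleQuantile k (fun j => sampleQuantile ℓ (fun i => (S j i : EReal)))

/-- The prediction set `{y | s (x, y) ≤ S_(ℓ, k)}` built with the score function `s` from the
calibration data `z j i` (agent `j`, data point `i`). -/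
def qqPredictionSet {𝒳 𝒴 : Type*} {m n : ℕ} (s : 𝒳 × 𝒴 → ℝ) (z : Fin m → Fin n → 𝒳 × 𝒴)
    (ℓ k : ℕ) (x : 𝒳) : Set 𝒴 :=
  {y | (s (x, y) : EReal) ≤ qqEstimator ℓ k (fun j i => s (z j i))}

/-- The training-conditional miscoverage rate `α_{ℓ,k}(D) = P(Y ∉ C_{ℓ,k}(X) | D)`, where the data
set `D` consists of the learning set `L` and of the calibration data `Z`, the score function is
`s (L ω)`, and `Z₀ = (X, Y)` is the test point. -/
def qqMiscoverage {Ω Λ 𝒳 𝒴 : Type*} [MeasurableSpace Ω] [MeasurableSpace Λ]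
    [MeasurableSpace 𝒳] [MeasurableSpace 𝒴] {m n : ℕ} (P : Measure Ω)
    (s : Λ → 𝒳 × 𝒴 → ℝ) (L : Ω → Λ) (Z : Fin m → Fin n → Ω → 𝒳 × 𝒴) (Z₀ : Ω → 𝒳 × 𝒴)
    (ℓ k : ℕ) : Ω → ℝ :=
  P⟦{ω | (Z₀ ω).2 ∉ qqPredictionSet (s (L ω)) (fun j i => Z j i ω) ℓ k (Z₀ ω).1} |
    MeasurableSpace.comap (fun ω => (L ω, fun j i => Z j i ω)) inferInstance⟧

/-- `Δ(β) = 12 max {2 √(log (1/β)), 1}`. -/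
def coverageDelta (β : ℝ) : ℝ := 12 * max (2 * √(Real.log (1 / β))) 1

end

/-! Freeze the learning set. The scores are then i.i.d. with a law `ν`, which has no atom because
two independent scores almost surely differ, and the coverage is the `ν`-mass of the half-line below
`S_(ℓ,k)`. For `t` in `(0, 1)` choose `x` with `ν (Iic x) = t`. The event `S_(ℓ,k) ≤ x` forces
coverage at most `t`, and two rounds of binomial counting give it probability `F_{k:m}(F_{ℓ:n}(t))`
(`le_measureReal_coverage_le`, `ae_le_condExp_coverage_le`). It remains to bound the Beta-Beta `(1 -
β)`-quantile of the chosen pair by `coverageBound`; by minimality, one good competitor is enough for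
each algorithm.

Beta cdfs of order statistics are binomial tails, and the derivative of a tail is `n` times a
Bernstein polynomial. By Chebyshev these polynomials carry most of their mass on about `√n` indices
near `(n - 1)(1 - α)`, so averaging produces an `ℓ` whose cdf grows at rate of order `√n` just to
the right of `1 - α` (`exists_le_binomialTail_sub`). A step of order `1/√(mn)` thus raises `F_{ℓ:n}`
by order `1/√m`. By Chernoff this is the scale on which `F_{k:m}` passes from below `β` to above `1
- β`, so there is room for a suitable `k`. -/

/-! ### Binomial tails, Beta cdfs and their quantiles -/

/-- The probability that a binomial variable with parameters `N` and `p` is at least `r`. -/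
noncomputable def binomialTail (N r : ℕ) (p : ℝ) : ℝ :=
  ∑ j ∈ Finset.Icc r N, (bernsteinPolynomial ℝ N j).eval p

theorem eval_bernstein (N j : ℕ) (p : ℝ) :
    (bernsteinPolynomial ℝ N j).eval p = N.choose j * p ^ j * (1 - p) ^ (N - j) := by
  simp [bernsteinPolynomial]

theorem eval_bernstein_nonneg (N j : ℕ) {p : ℝ} (h0 : 0 ≤ p) (h1 : p ≤ 1) :
    0 ≤ (bernsteinPolynomial ℝ N j).eval p := by
  rw [eval_bernstein]
  have : 0 ≤ 1 - p := by linarith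
  positivity

theorem sum_eval_bernstein (N : ℕ) (p : ℝ) :
    ∑ j ∈ Finset.range (N + 1), (bernsteinPolynomial ℝ N j).eval p = 1 := by
  rw [← Polynomial.eval_finsetSum, bernsteinPolynomial.sum, Polynomial.eval_one]

theorem sum_sq_mul_eval_bernstein (N : ℕ) (p : ℝ) :
    ∑ j ∈ Finset.range (N + 1), (N * p - j) ^ 2 * (bernsteinPolynomial ℝ N j).eval p =
      N * p * (1 - p) := by
  have h := congrArg (Polynomial.eval p) (bernsteinPolynomial.variance ℝ N)
  simpa [Polynomial.eval_finsetSum] using h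

theorem sum_range_add_binomialTail (N r : ℕ) (hr : r ≤ N + 1) (p : ℝ) :
    ∑ j ∈ Finset.range r, (bernsteinPolynomial ℝ N j).eval p + binomialTail N r p = 1 := by
  rw [← sum_eval_bernstein N p, binomialTail, ← Finset.sum_range_add_sum_Ico _ hr]
  rfl

/-- The derivative of a binomial tail is the density of the Beta distribution. -/
theorem hasDerivAt_binomialTail {N r : ℕ} (hr : 1 ≤ r) (hrN : r ≤ N) (p : ℝ) :
    HasDerivAt (binomialTail N r) (N * (bernsteinPolynomial ℝ (N - 1) (r - 1)).eval p) p := by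
  have h : ∀ j ∈ Finset.Icc r N, HasDerivAt (fun x => (bernsteinPolynomial ℝ N j).eval x)
      (N * (bernsteinPolynomial ℝ (N - 1) (j - 1)).eval p -
        N * (bernsteinPolynomial ℝ (N - 1) j).eval p) p := by
    intro j hj
    obtain ⟨i, rfl⟩ : ∃ i, j = i + 1 := ⟨j - 1, by have := (Finset.mem_Icc.1 hj).1; omega⟩
    have := (bernsteinPolynomial ℝ N (i + 1)).hasDerivAt p
    rw [bernsteinPolynomial.derivative_succ] at this
    simpa [mul_sub] using this
  have h2 := HasDerivAt.fun_sum h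
  have h3 : ∑ j ∈ Finset.Icc r N, (N * (bernsteinPolynomial ℝ (N - 1) (j - 1)).eval p -
        N * (bernsteinPolynomial ℝ (N - 1) j).eval p) =
      N * (bernsteinPolynomial ℝ (N - 1) (r - 1)).eval p := by
    -- The derivatives telescope; the boundary term at `j = N` vanishes because its index exceeds
    -- the degree `N - 1`.
    have := Finset.sum_Ico_sub (fun j => -(N * (bernsteinPolynomial ℝ (N - 1) (j - 1)).eval p))
      (show r ≤ N + 1 by omega)
    simp only [Nat.add_sub_cancel, neg_sub_neg] at this
    rw [bernsteinPolynomial.eq_zero_of_lt ℝ (show N - 1 < N by omega)] at this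
    simpa [Finset.Ico_add_one_right_eq_Icc] using this
  rw [h3] at h2
  exact h2

theorem binomialTail_zero {N r : ℕ} (hr : 1 ≤ r) : binomialTail N r 0 = 0 := by
  refine Finset.sum_eq_zero fun j hj => ?_
  rw [bernsteinPolynomial.eval_at_0, if_neg]
  have := (Finset.mem_Icc.1 hj).1
  omega

theorem betaPDFReal_eq_bernstein {N r : ℕ} (hr : 1 ≤ r) (hrN : r ≤ N) {x : ℝ} (h0 : 0 < x)
    (h1 : x < 1) :
    betaPDFReal r ((N : ℝ) - r + 1) x = N * (bernsteinPolynomial ℝ (N - 1) (r - 1)).eval x := by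
  obtain ⟨i, rfl⟩ : ∃ i, r = i + 1 := ⟨r - 1, by omega⟩
  obtain ⟨d, rfl⟩ : ∃ d, N = i + 1 + d := ⟨N - (i + 1), by omega⟩
  have e1 : ((i + 1 + d : ℕ) : ℝ) - (i + 1 : ℕ) + 1 = (d : ℝ) + 1 := by push_cast; ring
  rw [e1, betaPDFReal, if_pos ⟨h0, h1⟩, eval_bernstein, beta]
  have e2 : ((i + 1 : ℕ) : ℝ) + ((d : ℝ) + 1) = ((i + 1 + d : ℕ) : ℝ) + 1 := by push_cast; ring
  rw [e2, Real.Gamma_nat_eq_factorial, Real.Gamma_nat_eq_factorial]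
  have e3 : Real.Gamma ((i + 1 : ℕ) : ℝ) = i.factorial := by
    push_cast
    exact Real.Gamma_nat_eq_factorial i
  have e4 : i + 1 + d - 1 = i + d := by omega
  have e5 : i + 1 + d = (i + d) + 1 := by omega
  have e6 : i + d - i = d := by omega
  have e7 : ((i + d).choose i : ℝ) * i.factorial * d.factorial = (i + d).factorial := by
    have := Nat.choose_mul_factorial_mul_factorial (Nat.le_add_right i d)
    rw [e6] at this
    exact_mod_cast this
  rw [e3, e4, e5, Nat.factorial_succ, Nat.add_sub_cancel, e6]
  push_cast
  rw [← e7]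
  have hx : x ^ ((i : ℝ) + 1 - 1) = x ^ i := by
    rw [add_sub_cancel_right, Real.rpow_natCast]
  have hy : (1 - x) ^ ((d : ℝ) + 1 - 1) = (1 - x) ^ d := by
    rw [add_sub_cancel_right, Real.rpow_natCast]
  rw [hx, hy]
  have f1 : (i.factorial : ℝ) ≠ 0 := by positivity
  have f2 : (d.factorial : ℝ) ≠ 0 := by positivity
  field_simp

theorem orderStatCDF_of_nonpos (r N : ℕ) {t : ℝ} (ht : t ≤ 0) : orderStatCDF r N t = 0 := by
  have : betaMeasure (r : ℝ) ((N : ℝ) - r + 1) (Iic t) = 0 := by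
    rw [betaMeasure, withDensity_apply _ measurableSet_Iic]
    exact setLIntegral_eq_zero measurableSet_Iic
      fun x hx => betaPDF_eq_zero_of_nonpos (le_trans hx ht)
  simp [orderStatCDF, measureReal_def, this]

/-- The tail vanishes at `0` and its derivative is the Beta density, so the fundamental theorem of
calculus identifies the two. -/
theorem orderStatCDF_eq_binomialTail {N r : ℕ} (hr : 1 ≤ r) (hrN : r ≤ N) {t : ℝ} (h0 : 0 ≤ t)
    (h1 : t ≤ 1) : orderStatCDF r N t = binomialTail N r t := by
  have hd : ∀ x ∈ uIcc 0 t, HasDerivAt (binomialTail N r)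
      (N * (bernsteinPolynomial ℝ (N - 1) (r - 1)).eval x) x :=
    fun x _ => hasDerivAt_binomialTail hr hrN x
  have hc : Continuous fun x : ℝ => N * (bernsteinPolynomial ℝ (N - 1) (r - 1)).eval x := by
    fun_prop
  have key := intervalIntegral.integral_eq_sub_of_hasDerivAt hd (hc.intervalIntegrable _ _)
  rw [binomialTail_zero hr, sub_zero, intervalIntegral.integral_of_le h0,
    integral_Ioc_eq_integral_Ioo] at key
  rw [← key, orderStatCDF, measureReal_def, betaMeasure, withDensity_apply _ measurableSet_Iic,
    ← Iic_union_Ioc_eq_Iic h0, lintegral_union measurableSet_Ioc (Iic_disjoint_Ioc le_rfl),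
    setLIntegral_eq_zero measurableSet_Iic fun x hx => betaPDF_eq_zero_of_nonpos hx, zero_add,
    setLIntegral_congr Ioo_ae_eq_Ioc.symm]
  rw [integral_eq_lintegral_of_nonneg_ae]
  · congr 1
    refine setLIntegral_congr_fun measurableSet_Ioo fun x hx => ?_
    have hx1 : x < 1 := lt_of_lt_of_le hx.2 h1
    rw [betaPDF, betaPDFReal_eq_bernstein hr hrN hx.1 hx1]
  · refine (ae_restrict_iff' measurableSet_Ioo).2 (Filter.Eventually.of_forall fun x hx => ?_)
    exact mul_nonneg (Nat.cast_nonneg _)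
      (eval_bernstein_nonneg _ _ hx.1.le (hx.2.le.trans h1))
  · exact hc.aestronglyMeasurable

theorem binomialTail_one {N r : ℕ} (hrN : r ≤ N) : binomialTail N r 1 = 1 := by
  rw [binomialTail, Finset.sum_eq_single N]
  · simp [bernsteinPolynomial.eval_at_1]
  · intro j _ hj
    simp [bernsteinPolynomial.eval_at_1, hj]
  · intro h
    exact absurd (Finset.mem_Icc.2 ⟨hrN, le_rfl⟩) h

theorem isProbabilityMeasure_beta {N r : ℕ} (hr : 1 ≤ r) (hrN : r ≤ N) :
    IsProbabilityMeasure (betaMeasure (r : ℝ) ((N : ℝ) - r + 1)) := by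
  have h1 : (1 : ℝ) ≤ r := by exact_mod_cast hr
  have h2 : (r : ℝ) ≤ N := by exact_mod_cast hrN
  exact isProbabilityMeasureBeta (by linarith) (by linarith)

theorem orderStatCDF_mono {N r : ℕ} (hr : 1 ≤ r) (hrN : r ≤ N) : Monotone (orderStatCDF r N) := by
  have := isProbabilityMeasure_beta hr hrN
  intro s t hst
  exact measureReal_mono (Iic_subset_Iic.2 hst)

theorem orderStatCDF_le_one {N r : ℕ} (hr : 1 ≤ r) (hrN : r ≤ N) (t : ℝ) :
    orderStatCDF r N t ≤ 1 := by
  have := isProbabilityMeasure_beta hr hrN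
  exact measureReal_le_one

theorem orderStatCDF_nonneg (r N : ℕ) (t : ℝ) : 0 ≤ orderStatCDF r N t := measureReal_nonneg

theorem orderStatCDF_of_one_le {N r : ℕ} (hr : 1 ≤ r) (hrN : r ≤ N) {t : ℝ} (ht : 1 ≤ t) :
    orderStatCDF r N t = 1 := by
  refine le_antisymm (orderStatCDF_le_one hr hrN t) ?_
  have := orderStatCDF_mono hr hrN ht
  rwa [orderStatCDF_eq_binomialTail hr hrN zero_le_one le_rfl, binomialTail_one hrN] at this

theorem continuous_binomialTail (N r : ℕ) : Continuous (binomialTail N r) := by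
  unfold binomialTail
  fun_prop

/-- The quantile function is the lower adjoint of the cdf. -/
theorem orderStatQuantile_le_iff {N r : ℕ} (hr : 1 ≤ r) (hrN : r ≤ N) {p : ℝ} (h0 : 0 < p)
    (h1 : p ≤ 1) (t : ℝ) : orderStatQuantile r N p ≤ t ↔ p ≤ orderStatCDF r N t := by
  set s := {t : ℝ | p ≤ orderStatCDF r N t} with hs
  have hsub : s ⊆ Ici 0 := by
    intro x hx
    by_contra hx0
    have hx' : p ≤ orderStatCDF r N x := hx
    rw [orderStatCDF_of_nonpos r N (not_le.1 hx0).le] at hx'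
    linarith
  have hbdd : BddBelow s := ⟨0, hsub⟩
  have hne : s.Nonempty := 
    ⟨1, by change p ≤ _; rwa [orderStatCDF_of_one_le hr hrN le_rfl]⟩
  refine ⟨fun h => ?_, fun h => csInf_le hbdd h⟩
  -- The infimum is attained because `s` is closed. The cdf is polynomial only on `[0, 1]`, hence
  -- the splitting at `1`.
  have hs1 : s = (Icc 0 1 ∩ binomialTail N r ⁻¹' Ici p) ∪ Ici 1 := by
    ext x
    constructor
    · intro hx
      have hx0 : 0 ≤ x := hsub hx
      rcases le_total x 1 with hx1 | hx1
      · left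
        refine ⟨⟨hx0, hx1⟩, ?_⟩
        have hx' : p ≤ orderStatCDF r N x := hx
        rwa [orderStatCDF_eq_binomialTail hr hrN hx0 hx1] at hx'
      · exact Or.inr hx1
    · rintro (⟨hx, hx'⟩ | hx)
      · change p ≤ orderStatCDF r N x
        rw [orderStatCDF_eq_binomialTail hr hrN hx.1 hx.2]
        exact hx'
      · change p ≤ orderStatCDF r N x
        rw [orderStatCDF_of_one_le hr hrN hx]
        exact h1
  have hcl : IsClosed s := by
    rw [hs1]
    exact (isClosed_Icc.inter (isClosed_Ici.preimage (continuous_binomialTail N r))).union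
      isClosed_Ici
  have hmem : sInf s ∈ s := hcl.csInf_mem hne hbdd
  exact le_trans hmem (orderStatCDF_mono hr hrN h)

theorem orderStatQuantile_pos {N r : ℕ} (hr : 1 ≤ r) (hrN : r ≤ N) {p : ℝ} (h0 : 0 < p)
    (h1 : p ≤ 1) : 0 < orderStatQuantile r N p := by
  by_contra h
  have := (orderStatQuantile_le_iff hr hrN h0 h1 0).1 (not_lt.1 h)
  rw [orderStatCDF_of_nonpos r N le_rfl] at this
  linarith

theorem orderStatQuantile_le_one {N r : ℕ} (hr : 1 ≤ r) (hrN : r ≤ N) {p : ℝ} (h0 : 0 < p)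
    (h1 : p ≤ 1) : orderStatQuantile r N p ≤ 1 := by
  rw [orderStatQuantile_le_iff hr hrN h0 h1, orderStatCDF_of_one_le hr hrN le_rfl]
  exact h1

/-- Two adjunctions compose: the inner quantile lies in `(0, 1]`, so it is an admissible level for
the outer one. Bounds on quantiles thereby become bounds on binomial tails. -/
theorem betaBetaQuantile_le_iff {n m ℓ k : ℕ} (hℓ : 1 ≤ ℓ) (hℓn : ℓ ≤ n) (hk : 1 ≤ k) (hkm : k ≤ m)
    {p : ℝ} (h0 : 0 < p) (h1 : p ≤ 1) (t : ℝ) :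
    betaBetaQuantile n m ℓ k p ≤ t ↔ p ≤ orderStatCDF k m (orderStatCDF ℓ n t) := by
  rw [betaBetaQuantile, orderStatQuantile_le_iff hℓ hℓn (orderStatQuantile_pos hk hkm h0 h1)
    (orderStatQuantile_le_one hk hkm h0 h1), orderStatQuantile_le_iff hk hkm h0 h1]

/-! ### Chernoff bounds for the binomial tails -/

/-- Symmetrization. Let `B` be the centred moment generating function at `x` and `A` the one at
`-x`. Convexity gives `A ≥ 1`, so `B ≤ A * B`, and `A * B` belongs to a difference of two
independent copies, which is symmetric and bounded by `cosh x ≤ exp (x² / 2)`. -/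
theorem bernoulli_mgf_le {p : ℝ} (h0 : 0 ≤ p) (h1 : p ≤ 1) (x : ℝ) :
    1 - p + p * Real.exp x ≤ Real.exp (x * p + x ^ 2 / 2) := by
  have hA : 1 ≤ (1 - p) * Real.exp (p * x) + p * Real.exp (-((1 - p) * x)) := by
    have a1 := Real.add_one_le_exp (p * x)
    have a2 := Real.add_one_le_exp (-((1 - p) * x))
    nlinarith [mul_le_mul_of_nonneg_left a1 (sub_nonneg.2 h1), mul_le_mul_of_nonneg_left a2 h0]
  set B := (1 - p) * Real.exp (-(p * x)) + p * Real.exp ((1 - p) * x) with hB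
  have hB0 : 0 ≤ B := by
    have : 0 ≤ 1 - p := by linarith
    positivity
  have hprod : ((1 - p) * Real.exp (p * x) + p * Real.exp (-((1 - p) * x))) * B =
      (1 - p) ^ 2 + p ^ 2 + 2 * (p * (1 - p)) * Real.cosh x := by
    have e1 : Real.exp (p * x) * Real.exp (-(p * x)) = 1 := by rw [← Real.exp_add]; simp
    have e2 : Real.exp (-((1 - p) * x)) * Real.exp ((1 - p) * x) = 1 := by
      rw [← Real.exp_add]; simp
    have e3 : Real.exp (p * x) * Real.exp ((1 - p) * x) = Real.exp x := by
      rw [← Real.exp_add]; ring_nf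
    have e4 : Real.exp (-((1 - p) * x)) * Real.exp (-(p * x)) = Real.exp (-x) := by
      rw [← Real.exp_add]; ring_nf
    rw [hB, Real.cosh_eq]
    linear_combination (1 - p) ^ 2 * e1 + p ^ 2 * e2 + (1 - p) * p * e3 + p * (1 - p) * e4
  have hcosh : (1 - p) ^ 2 + p ^ 2 + 2 * (p * (1 - p)) * Real.cosh x ≤ Real.exp (x ^ 2 / 2) := by
    have c1 := Real.one_le_cosh x
    have c2 := Real.cosh_le_exp_half_sq x
    have : 0 ≤ 1 - p := by linarith
    nlinarith [mul_nonneg (sub_nonneg.2 c1) (add_nonneg (sq_nonneg p) (sq_nonneg (1 - p)))]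
  have hBle : B ≤ Real.exp (x ^ 2 / 2) := by
    calc B = 1 * B := (one_mul B).symm
      _ ≤ _ := mul_le_mul_of_nonneg_right hA hB0
      _ = _ := hprod
      _ ≤ _ := hcosh
  have hfin : 1 - p + p * Real.exp x = Real.exp (p * x) * B := by
    have e1 : Real.exp (p * x) * Real.exp (-(p * x)) = 1 := by rw [← Real.exp_add]; simp
    have e3 : Real.exp (p * x) * Real.exp ((1 - p) * x) = Real.exp x := by
      rw [← Real.exp_add]; ring_nf
    rw [hB]
    linear_combination (-(1 - p)) * e1 - p * e3
  rw [hfin, mul_comm x p, Real.exp_add]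
  exact mul_le_mul_of_nonneg_left hBle (Real.exp_nonneg _)

theorem sum_exp_mul_eval_bernstein_le (N : ℕ) {p : ℝ} (h0 : 0 ≤ p) (h1 : p ≤ 1) (x : ℝ) :
    ∑ j ∈ Finset.range (N + 1), Real.exp (x * j) * (bernsteinPolynomial ℝ N j).eval p ≤
      Real.exp (N * (x * p + x ^ 2 / 2)) := by
  have : ∑ j ∈ Finset.range (N + 1), Real.exp (x * j) * (bernsteinPolynomial ℝ N j).eval p =
      (p * Real.exp x + (1 - p)) ^ N := by
    rw [add_pow]
    refine Finset.sum_congr rfl fun j _ => ?_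
    rw [eval_bernstein, mul_comm x, Real.exp_nat_mul, mul_pow]
    ring
  rw [this, Real.exp_nat_mul, add_comm]
  refine pow_le_pow_left₀ ?_ (bernoulli_mgf_le h0 h1 x) N
  have : 0 ≤ 1 - p := by linarith
  positivity

/-- Exponential Markov inequality at the optimal parameter `x = (c - N p) / N`. Its sign is left
free, so that both tails are covered. -/
theorem chernoff_bernstein {N : ℕ} (hN : 0 < N) {p : ℝ} (h0 : 0 ≤ p) (h1 : p ≤ 1) (x c : ℝ)
    (hx : N * x = c - N * p) (s : Finset ℕ) (hs : s ⊆ Finset.range (N + 1))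
    (hsc : ∀ j ∈ s, x * c ≤ x * j) :
    ∑ j ∈ s, (bernsteinPolynomial ℝ N j).eval p ≤ Real.exp (-((c - N * p) ^ 2 / (2 * N))) := by
  have hN' : (0 : ℝ) < N := by exact_mod_cast hN
  have step : Real.exp (x * c) * ∑ j ∈ s, (bernsteinPolynomial ℝ N j).eval p ≤
      Real.exp (N * (x * p + x ^ 2 / 2)) := by
    refine le_trans ?_ (sum_exp_mul_eval_bernstein_le N h0 h1 x)
    rw [Finset.mul_sum]
    refine le_trans (Finset.sum_le_sum fun j hj => ?_)
      (Finset.sum_le_sum_of_subset_of_nonneg hs fun j _ _ =>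
        mul_nonneg (Real.exp_nonneg _) (eval_bernstein_nonneg N j h0 h1))
    exact mul_le_mul_of_nonneg_right (Real.exp_le_exp.2 (hsc j hj)) (eval_bernstein_nonneg N j h0 h1)
  have hexp : Real.exp (-((c - N * p) ^ 2 / (2 * N))) =
      Real.exp (N * (x * p + x ^ 2 / 2)) / Real.exp (x * c) := by
    rw [← Real.exp_sub]
    congr 1
    rw [← hx]
    have : c = N * x + N * p := by linarith
    rw [this]
    field_simp
    ring
  rw [hexp, le_div_iff₀ (Real.exp_pos _), mul_comm]
  exact step

theorem binomialTail_le_exp {N r : ℕ} (hN : 0 < N) {p : ℝ} (h0 : 0 ≤ p) (h1 : p ≤ 1)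
    (hr : N * p ≤ r) : binomialTail N r p ≤ Real.exp (-((r - N * p) ^ 2 / (2 * N))) := by
  have hN' : (0 : ℝ) < N := by exact_mod_cast hN
  have hx0 : (0 : ℝ) ≤ (r - N * p) / N := div_nonneg (by linarith) hN'.le
  refine chernoff_bernstein hN h0 h1 ((r - N * p) / N) r (by field_simp) _ ?_ ?_
  · intro j hj
    have := (Finset.mem_Icc.1 hj).2
    exact Finset.mem_range.2 (by omega)
  · intro j hj
    have : (r : ℝ) ≤ j := by exact_mod_cast (Finset.mem_Icc.1 hj).1
    exact mul_le_mul_of_nonneg_left this hx0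

/-- Chernoff for the complement: failing to reach `r` means at most `r - 1` successes, hence the
shift by one. -/
theorem one_sub_exp_le_binomialTail {N r : ℕ} (hr1 : 1 ≤ r) (hrN : r ≤ N) {p : ℝ} (h0 : 0 ≤ p)
    (h1 : p ≤ 1) (hr : (r : ℝ) - 1 ≤ N * p) :
    1 - Real.exp (-((N * p - (r - 1)) ^ 2 / (2 * N))) ≤ binomialTail N r p := by
  have hN : 0 < N := by omega
  have hN' : (0 : ℝ) < N := by exact_mod_cast hN
  have hx0 : ((r : ℝ) - 1 - N * p) / N ≤ 0 := div_nonpos_of_nonpos_of_nonneg (by linarith) hN'.le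
  have key := chernoff_bernstein hN h0 h1 (((r : ℝ) - 1 - N * p) / N) ((r : ℝ) - 1) (by field_simp)
    (Finset.range r) (Finset.range_subset_range.2 (by omega)) (by
      intro j hj
      have : (j : ℝ) + 1 ≤ r := by exact_mod_cast Finset.mem_range.1 hj
      exact mul_le_mul_of_nonpos_left (by linarith) hx0)
  have hsum := sum_range_add_binomialTail N r (by omega) p
  have hsq : ((r : ℝ) - 1 - N * p) ^ 2 = (N * p - (r - 1)) ^ 2 := by ring
  rw [hsq] at key
  linarith

/-! ### An order whose Beta distribution has a large mass to the right of a given point -/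

theorem card_le_of_forall_abs_sub_le {s : Finset ℕ} {c W : ℝ} (hW : 0 ≤ W)
    (hs : ∀ j ∈ s, |c - j| ≤ W) : (s.card : ℝ) ≤ 2 * W + 1 := by
  rcases s.eq_empty_or_nonempty with rfl | hne
  · simp
    linarith
  · have hsub : s ⊆ Finset.Icc (s.min' hne) (s.max' hne) := fun j hj =>
      Finset.mem_Icc.2 ⟨s.min'_le j hj, s.le_max' j hj⟩
    have hle : s.min' hne ≤ s.max' hne := s.min'_le _ (s.max'_mem hne)
    have hcard := Finset.card_le_card hsub
    rw [Nat.card_Icc] at hcard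
    have hcard' : s.card + s.min' hne ≤ s.max' hne + 1 := by omega
    have h1 := abs_le.1 (hs _ (s.min'_mem hne))
    have h2 := abs_le.1 (hs _ (s.max'_mem hne))
    have h3 : (s.card : ℝ) + (s.min' hne : ℕ) ≤ (s.max' hne : ℕ) + 1 := by exact_mod_cast hcard'
    linarith [h1.2, h2.1]

/-- Chebyshev's inequality for the binomial distribution, outside of a set `s`. -/
theorem sq_mul_sum_sdiff_eval_bernstein_le (N : ℕ) {p d : ℝ} (h0 : 0 ≤ p) (h1 : p ≤ 1)
    (s : Finset ℕ) (hs : ∀ j ∈ Finset.range (N + 1) \ s, d ≤ (N * p - j) ^ 2) :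
    d * ∑ j ∈ Finset.range (N + 1) \ s, (bernsteinPolynomial ℝ N j).eval p ≤
      N * p * (1 - p) := by
  rw [← sum_sq_mul_eval_bernstein, Finset.mul_sum]
  refine le_trans (Finset.sum_le_sum fun j hj => ?_)
    (Finset.sum_le_sum_of_subset_of_nonneg Finset.sdiff_subset fun j _ _ =>
      mul_nonneg (sq_nonneg _) (eval_bernstein_nonneg N j h0 h1))
  exact mul_le_mul_of_nonneg_right (hs j hj) (eval_bernstein_nonneg N j h0 h1)

theorem exists_le_binomialTail_sub {n : ℕ} {a h : ℝ} (ha0 : 0 < a) (ha1 : a < 1)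
    (hn : 100 ≤ n * (a * (1 - a))) (hh : 0 < h) (hhn : h ≤ √(a * (1 - a)) / √n) :
    ∃ ℓ, 1 ≤ ℓ ∧ ℓ ≤ n ∧ a + h ≤ 1 ∧
      11 / 100 * (√n * h / √(a * (1 - a))) ≤ binomialTail n ℓ (a + h) - binomialTail n ℓ a := by
  have hv0 : 0 < a * (1 - a) := mul_pos ha0 (by linarith)
  have hn0 : (0 : ℝ) < n := by
    by_contra hcon
    nlinarith [not_lt.1 hcon]
  set σ := √(a * (1 - a)) with hσ
  set R := √(n : ℝ) with hR
  have hσ0 : 0 < σ := Real.sqrt_pos.2 hv0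
  have hR0 : 0 < R := Real.sqrt_pos.2 hn0
  have hσ2 : σ ^ 2 = a * (1 - a) := Real.sq_sqrt hv0.le
  have hR2 : R ^ 2 = n := Real.sq_sqrt hn0.le
  have hRσ : 10 ≤ R * σ := by
    rw [← hσ2, ← hR2] at hn
    nlinarith [mul_pos hR0 hσ0]
  have hhR : h * R ≤ σ := (le_div_iff₀ hR0).1 hhn
  have hh10 : 10 * h ≤ a * (1 - a) := by
    rw [← hσ2]
    nlinarith [mul_le_mul_of_nonneg_left hRσ hh.le]
  have hah : a + h ≤ 1 := by nlinarith
  have hn1 : 1 ≤ n := by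
    have : 0 < n := by exact_mod_cast hn0
    omega
  obtain ⟨N, rfl⟩ : ∃ N, n = N + 1 := ⟨n - 1, by omega⟩
  have hNn : (N : ℝ) + 1 = R ^ 2 := by rw [hR2]; push_cast; ring
  -- A window of three standard deviations. Since `R * σ ≥ 10`, it has at most `6.1 * R * σ`
  -- indices. For `u` in `[a, a + h]` the mean moves by at most `R * σ`, so two deviations remain
  -- and Chebyshev leaves at most `1.1 / 4 < 0.3` outside.
  set I := (Finset.range (N + 1)).filter fun j : ℕ => |(N : ℝ) * a - j| ≤ 3 * (R * σ) with hI
  have hIN : ∀ j ∈ I, j ≤ N := by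
    intro j hj
    have := Finset.mem_range.1 (Finset.mem_filter.1 hj).1
    omega
  have hcard : (I.card : ℝ) ≤ 61 / 10 * (R * σ) := by
    have := card_le_of_forall_abs_sub_le (s := I) (c := N * a) (W := 3 * (R * σ)) (by positivity)
      fun j hj => (Finset.mem_filter.1 hj).2
    linarith
  have hmass : ∀ u ∈ Icc a (a + h),
      7 / 10 ≤ ∑ j ∈ I, (bernsteinPolynomial ℝ N j).eval u := by
    intro u hu
    have hu0 : 0 ≤ u := ha0.le.trans hu.1
    have hu1 : u ≤ 1 := hu.2.trans hah
    have hsplit := Finset.sum_sdiff (f := fun j => (bernsteinPolynomial ℝ N j).eval u)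
      (Finset.filter_subset (fun j : ℕ => |(N : ℝ) * a - j| ≤ 3 * (R * σ)) (Finset.range (N + 1)))
    rw [sum_eval_bernstein, ← hI] at hsplit
    have hcheb := sq_mul_sum_sdiff_eval_bernstein_le N hu0 hu1 (d := (2 * (R * σ)) ^ 2) I (by
      intro j hj
      have hj' : 3 * (R * σ) < |(N : ℝ) * a - j| := by
        by_contra hcon
        exact (Finset.mem_sdiff.1 hj).2
          (Finset.mem_filter.2 ⟨(Finset.mem_sdiff.1 hj).1, not_lt.1 hcon⟩)
      have hNu : N * (u - a) ≤ R * σ := by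
        have : N * (u - a) ≤ R ^ 2 * h :=
          mul_le_mul (by linarith) (by linarith [hu.2]) (by linarith [hu.1]) (by positivity)
        nlinarith
      have hNu0 : 0 ≤ N * (u - a) := mul_nonneg (Nat.cast_nonneg _) (by linarith [hu.1])
      have h2 : 2 * (R * σ) ≤ |(N : ℝ) * u - j| := by
        have e : (N : ℝ) * a - j = (N * u - j) - N * (u - a) := by ring
        rw [e] at hj'
        have := abs_sub ((N : ℝ) * u - j) (N * (u - a))
        rw [abs_of_nonneg hNu0] at this
        linarith
      rw [← sq_abs ((N : ℝ) * u - j)]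
      exact pow_le_pow_left₀ (by positivity) h2 2)
    have hvar : N * u * (1 - u) ≤ R ^ 2 * (11 / 10 * σ ^ 2) := by
      rw [mul_assoc]
      refine mul_le_mul (by linarith) ?_ (mul_nonneg hu0 (by linarith)) (by positivity)
      rw [hσ2]
      nlinarith [sq_nonneg (u - a), hu.1, hu.2, mul_nonneg ha0.le (sub_nonneg.2 hu.1)]
    have hRσ2 : 0 < R ^ 2 * σ ^ 2 := by positivity
    have h3 : ∑ j ∈ Finset.range (N + 1) \ I, (bernsteinPolynomial ℝ N j).eval u ≤ 3 / 10 := by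
      by_contra hcon
      nlinarith [mul_lt_mul_of_pos_left (not_le.1 hcon) hRσ2]
    linarith
  have hder : ∀ u, HasDerivAt (fun x => ∑ j ∈ I, binomialTail (N + 1) (j + 1) x)
      (∑ j ∈ I, ((N + 1 : ℕ) : ℝ) * (bernsteinPolynomial ℝ N j).eval u) u := fun u =>
    HasDerivAt.fun_sum fun j hj => by
      simpa using hasDerivAt_binomialTail (N := N + 1) (r := j + 1) (by omega)
        (by have := hIN j hj; omega) u
  have hinc := (convex_Icc a (a + h)).mul_sub_le_image_sub_of_le_deriv
    (f := fun x => ∑ j ∈ I, binomialTail (N + 1) (j + 1) x) (C := R ^ 2 * (7 / 10))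
    (fun u _ => (hder u).continuousAt.continuousWithinAt)
    (fun u _ => (hder u).differentiableAt.differentiableWithinAt)
    (fun u hu => by
      rw [(hder u).deriv, ← Finset.mul_sum, hR2]
      exact mul_le_mul_of_nonneg_left (hmass u (interior_subset hu)) (Nat.cast_nonneg _))
    a ⟨le_rfl, by linarith⟩ (a + h) ⟨by linarith, le_rfl⟩ (by linarith)
  simp only [add_sub_cancel_left, ← Finset.sum_sub_distrib] at hinc
  -- Pigeonhole: if each order in the window gained less than claimed, the total gain would be at
  -- most `6.1 * 0.11 * R² * h = 0.671 * R² * h`, whereas integrating the derivative gives at least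
  -- `0.7 * R² * h`.
  by_contra hcon
  have hlt : ∀ j ∈ I, binomialTail (N + 1) (j + 1) (a + h) - binomialTail (N + 1) (j + 1) a ≤
      11 / 100 * (R * h / σ) := fun j hj => by
    by_contra h'
    exact hcon ⟨j + 1, by omega, by have := hIN j hj; omega, hah, (not_le.1 h').le⟩
  have hsum := Finset.sum_le_card_nsmul I _ _ hlt
  rw [nsmul_eq_mul] at hsum
  have h5 : (I.card : ℝ) * (11 / 100 * (R * h / σ)) ≤
      61 / 10 * (R * σ) * (11 / 100 * (R * h / σ)) :=
    mul_le_mul_of_nonneg_right hcard (by positivity)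
  have h6 : 61 / 10 * (R * σ) * (11 / 100 * (R * h / σ)) = 671 / 1000 * (R ^ 2 * h) := by
    field_simp
    ring
  have h7 : 0 < R ^ 2 * h := by positivity
  linarith

/-! ### Pairs of orders that satisfy the constraints and have a small Beta-Beta quantile -/

theorem exists_orderStatCDF_add_le {n m : ℕ} {α M : ℝ} (hα : α ∈ Ioo (0 : ℝ) 1)
    (hn : 100 ≤ n * ((1 - α) * α)) (hM : 1 ≤ M) (hm : 400 * M ^ 2 ≤ m) :
    ∃ ℓ, 1 ≤ ℓ ∧ ℓ ≤ n ∧ orderStatCDF ℓ n (1 - α) + 2 * M / √((m : ℝ) + 2) ≤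
      orderStatCDF ℓ n (1 - α + 12 * M / √(((m : ℝ) + 2) * ((n : ℝ) + 2))) := by
  obtain ⟨hα0, hα1⟩ := hα
  have hv0 : 0 < (1 - α) * α := mul_pos (by linarith) hα0
  have hv4 : (1 - α) * α ≤ 1 / 4 := by nlinarith [sq_nonneg (α - 1 / 2)]
  have hn400 : (400 : ℝ) ≤ n := by
    have : (n : ℝ) * ((1 - α) * α) ≤ n * (1 / 4) :=
      mul_le_mul_of_nonneg_left hv4 (Nat.cast_nonneg _)
    linarith
  set σ := √((1 - α) * α) with hσ
  set R := √(n : ℝ) with hR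
  set W := √((n : ℝ) + 2) with hW
  set w := √((m : ℝ) + 2) with hw
  have hσ0 : 0 < σ := Real.sqrt_pos.2 hv0
  have hR0 : 0 < R := Real.sqrt_pos.2 (by linarith)
  have hW0 : 0 < W := Real.sqrt_pos.2 (by linarith)
  have hw0 : 0 < w := Real.sqrt_pos.2 (by positivity)
  have hσ2 : σ ≤ 1 / 2 := by
    rw [hσ, Real.sqrt_le_left (by norm_num)]
    linarith
  have hRW : R ≤ W := Real.sqrt_le_sqrt (by linarith)
  have hWR : 10 * W ≤ 11 * R := by
    refine abs_le_of_sq_le_sq' ?_ (by positivity) |>.2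
    rw [mul_pow, mul_pow, hW, hR, Real.sq_sqrt (by linarith), Real.sq_sqrt (by linarith)]
    linarith
  set y := M / w with hy
  have hy0 : 0 < y := by positivity
  have hy1 : y ≤ 1 / 20 := by
    rw [hy, div_le_iff₀ hw0]
    have : 20 * M ≤ w := by
      rw [hw]
      refine Real.le_sqrt_of_sq_le ?_
      linarith
    linarith
  -- The step is truncated at `σ / W` to stay where the slope estimate holds; monotonicity recovers
  -- the full step afterwards.
  set h := min (12 * y) σ / W with hh
  have hmin0 : 0 < min (12 * y) σ := lt_min (by positivity) hσ0
  have hh0 : 0 < h := by positivity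
  have hhle : h ≤ σ / R := by
    rw [hh, div_le_div_iff₀ hW0 hR0]
    exact mul_le_mul (min_le_right _ _) hRW hR0.le hσ0.le
  obtain ⟨ℓ, hℓ1, hℓn, hle1, hinc⟩ := exists_le_binomialTail_sub (n := n) (a := 1 - α) (h := h)
    (by linarith) (by linarith) (by rwa [sub_sub_cancel]) hh0 (by rwa [sub_sub_cancel])
  rw [sub_sub_cancel, ← hσ, ← orderStatCDF_eq_binomialTail hℓ1 hℓn (by linarith) hle1,
    ← orderStatCDF_eq_binomialTail hℓ1 hℓn (by linarith) (by linarith)] at hinc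
  refine ⟨ℓ, hℓ1, hℓn, ?_⟩
  have hmono : orderStatCDF ℓ n (1 - α + h) ≤
      orderStatCDF ℓ n (1 - α + 12 * M / √(((m : ℝ) + 2) * ((n : ℝ) + 2))) := by
    refine orderStatCDF_mono hℓ1 hℓn ?_
    have : 12 * M / √(((m : ℝ) + 2) * ((n : ℝ) + 2)) = 12 * y / W := by
      rw [Real.sqrt_mul (by positivity), ← hW, ← hw, hy]
      field_simp
    rw [this, hh]
    have := div_le_div_of_nonneg_right (min_le_left (12 * y) σ) hW0.le
    linarith
  have hgain : 2 * M / w ≤ 11 / 100 * (R * h / σ) := by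
    have e1 : 2 * M / w = 2 * y := by rw [hy]; ring
    -- Source of the constants: without truncation, `σ ≤ 1 / 2` and the factor `12` suffice; with
    -- it, `y ≤ 1 / 20`, which is what `m ≥ 400 * M²` provides.
    have e2 : 2 * y * σ ≤ 1 / 10 * min (12 * y) σ := by
      rcases le_total (12 * y) σ with h1 | h1
      · rw [min_eq_left h1]
        nlinarith
      · rw [min_eq_right h1]
        nlinarith
    have e3 : 10 / 11 * min (12 * y) σ ≤ R * h := by
      rw [hh, ← mul_div_assoc R, le_div_iff₀ hW0]
      nlinarith
    rw [e1, ← mul_div_assoc (11 / 100 : ℝ), le_div_iff₀ hσ0]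
    linarith
  linarith

/-- The deviation `g = √(2 m log (1/β))` solves `exp (-g² / (2 m)) = β`. -/
theorem one_sub_le_orderStatCDF {m k : ℕ} {β p : ℝ} (hβ : β ∈ Ioo (0 : ℝ) 1) (hk : 1 ≤ k)
    (hkm : k ≤ m) (h0 : 0 ≤ p) (h1 : p ≤ 1)
    (h : (k : ℝ) - 1 + √(2 * m * Real.log (1 / β)) ≤ m * p) :
    1 - β ≤ orderStatCDF k m p := by
  have hm : (0 : ℝ) < m := by exact_mod_cast (show 0 < m by omega)
  have hL : 0 < Real.log (1 / β) := Real.log_pos ((one_lt_div hβ.1).2 hβ.2)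
  have hg := Real.sqrt_nonneg (2 * m * Real.log (1 / β))
  rw [orderStatCDF_eq_binomialTail hk hkm h0 h1]
  refine le_trans ?_ (one_sub_exp_le_binomialTail hk hkm h0 h1 (by linarith))
  have hsq : 2 * m * Real.log (1 / β) ≤ (m * p - (k - 1)) ^ 2 := by
    rw [← Real.sq_sqrt (show 0 ≤ 2 * m * Real.log (1 / β) by positivity)]
    exact pow_le_pow_left₀ hg (by linarith) 2
  have hlog : Real.log (1 / β) ≤ (m * p - (k - 1)) ^ 2 / (2 * m) := by
    rw [le_div_iff₀ (by positivity)]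
    linarith
  have : Real.exp (-((m * p - (k - 1)) ^ 2 / (2 * m))) ≤ β := by
    rw [← Real.le_log_iff_exp_le hβ.1]
    rw [one_div, Real.log_inv] at hlog
    linarith
  linarith

theorem orderStatCDF_lt {m k : ℕ} {β p : ℝ} (hβ : β ∈ Ioo (0 : ℝ) 1) (hk : 1 ≤ k)
    (hkm : k ≤ m) (h0 : 0 ≤ p) (h1 : p ≤ 1) (h : m * p + √(2 * m * Real.log (1 / β)) < k) :
    orderStatCDF k m p < β := by
  have hm : (0 : ℝ) < m := by exact_mod_cast (show 0 < m by omega)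
  have hL : 0 < Real.log (1 / β) := Real.log_pos ((one_lt_div hβ.1).2 hβ.2)
  have hg := Real.sqrt_nonneg (2 * m * Real.log (1 / β))
  rw [orderStatCDF_eq_binomialTail hk hkm h0 h1]
  refine lt_of_le_of_lt (binomialTail_le_exp (by omega) h0 h1 (by linarith)) ?_
  have hsq : 2 * m * Real.log (1 / β) < (k - m * p) ^ 2 := by
    rw [← Real.sq_sqrt (show 0 ≤ 2 * m * Real.log (1 / β) by positivity)]
    exact pow_lt_pow_left₀ (by linarith) hg two_ne_zero
  have hlog : Real.log (1 / β) < (k - m * p) ^ 2 / (2 * m) := by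
    rw [lt_div_iff₀ (by positivity)]
    linarith
  rw [← Real.lt_log_iff_exp_lt hβ.1]
  rw [one_div, Real.log_inv] at hlog
  linarith

section Choice

variable {n m : ℕ} {α β : ℝ}

/-- Since `4 log (1/β) ≤ M²`, the constants reflect `1/√2 < 0.72` and `1/√8 < 0.36`; the last one
uses `m / √(m + 2) ≥ 19`. -/
theorem sqrt_mul_sqrt_le {M : ℝ} (hβ : β ∈ Ioo (0 : ℝ) 1)
    (hM : M = max (2 * √(Real.log (1 / β))) 1) (hm : 400 * M ^ 2 ≤ m) :
    √(2 * m * Real.log (1 / β)) ≤ 72 / 100 * (m * (M / √((m : ℝ) + 2))) ∧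
      √(Real.log (1 / β) / (2 * ((m : ℝ) + 2))) ≤ 36 / 100 * (M / √((m : ℝ) + 2)) ∧
      1 ≤ 6 / 100 * (m * (M / √((m : ℝ) + 2))) := by
  have hL : 0 < Real.log (1 / β) := Real.log_pos ((one_lt_div hβ.1).2 hβ.2)
  have hM1 : 1 ≤ M := hM ▸ le_max_right _ _
  have hM2 : 2 * √(Real.log (1 / β)) ≤ M := hM ▸ le_max_left _ _
  have hLM : 4 * Real.log (1 / β) ≤ M ^ 2 := by
    have := pow_le_pow_left₀ (by positivity) hM2 2
    rw [mul_pow, Real.sq_sqrt hL.le] at this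
    linarith
  have hm400 : (400 : ℝ) ≤ m := by nlinarith
  have hw0 : 0 < √((m : ℝ) + 2) := Real.sqrt_pos.2 (by linarith)
  have hw2 : √((m : ℝ) + 2) ^ 2 = m + 2 := Real.sq_sqrt (by linarith)
  refine ⟨?_, ?_, ?_⟩
  · refine Real.sqrt_le_iff.2 ⟨by positivity, ?_⟩
    have e : (72 / 100 * ((m : ℝ) * (M / √((m : ℝ) + 2)))) ^ 2 =
        (72 / 100) ^ 2 * m ^ 2 * M ^ 2 / (m + 2) := by
      rw [mul_pow, mul_pow, div_pow M, hw2]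
      ring
    rw [e, le_div_iff₀ (by linarith)]
    have h1 : 2 * m * Real.log (1 / β) * ((m : ℝ) + 2) ≤ m * (M ^ 2 / 2) * (m + 2) := by
      refine mul_le_mul_of_nonneg_right ?_ (by linarith)
      nlinarith
    refine h1.trans ?_
    have h2 : 0 ≤ (m : ℝ) * M ^ 2 := by positivity
    nlinarith
  · refine Real.sqrt_le_iff.2 ⟨by positivity, ?_⟩
    rw [mul_pow, div_pow M, hw2, ← mul_div_assoc, div_le_div_iff₀ (by positivity) (by positivity)]
    nlinarith
  · rw [mul_div_assoc', mul_div_assoc', le_div_iff₀ hw0, one_mul]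
    refine (Real.sqrt_le_iff.2 ⟨by positivity, ?_⟩)
    have h1 : (m : ℝ) ^ 2 * 1 ≤ m ^ 2 * M ^ 2 :=
      mul_le_mul_of_nonneg_left (by nlinarith) (by positivity)
    nlinarith

/-- The right-hand side of the coverage bound. -/
noncomputable def coverageBound (n m : ℕ) (α β : ℝ) : ℝ :=
  1 - α + coverageDelta β / √(((m : ℝ) + 2) * ((n : ℝ) + 2))

/-- One `ℓ` serves both algorithms. With `y = M / √(m + 2)` the available gain is `2 m y`. QQC
spends two deviations, at most `1.44 m y`: one for feasibility, one for the `(1 - β)`-quantile.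
QQC-Fast spends its offset, about `0.36 m y`, one deviation, and a little for replacing `m` by `m +
1`. -/
theorem exists_order (hα : α ∈ Ioo (0 : ℝ) 1) (hβ : β ∈ Ioo (0 : ℝ) 1)
    (hn : 100 ≤ n * ((1 - α) * α)) (hm : 400 * (max (2 * √(Real.log (1 / β))) 1) ^ 2 ≤ m) :
    ∃ ℓ, 1 ≤ ℓ ∧ ℓ ≤ n ∧
      m * orderStatCDF ℓ n (1 - α) + 2 * √(2 * m * Real.log (1 / β)) ≤
        m * orderStatCDF ℓ n (coverageBound n m α β) ∧
      ((m : ℝ) + 1) *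
          (orderStatCDF ℓ n (1 - α) + √(Real.log (1 / β) / (2 * ((m : ℝ) + 2)))) +
          √(2 * m * Real.log (1 / β)) ≤
        m * orderStatCDF ℓ n (coverageBound n m α β) := by
  obtain ⟨M, hM⟩ : ∃ M, M = max (2 * √(Real.log (1 / β))) 1 := ⟨_, rfl⟩
  rw [← hM] at hm
  have hM1 : 1 ≤ M := hM ▸ le_max_right _ _
  obtain ⟨ℓ, hℓ1, hℓn, hℓ⟩ := exists_orderStatCDF_add_le hα hn hM1 hm
  obtain ⟨b1, b2, b3⟩ := sqrt_mul_sqrt_le hβ hM hm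
  have hm400 : (400 : ℝ) ≤ m := by nlinarith
  rw [hM, ← coverageDelta, ← hM, ← coverageBound] at hℓ
  have hstep := mul_le_mul_of_nonneg_left hℓ (Nat.cast_nonneg (α := ℝ) m)
  have hF := orderStatCDF_le_one hℓ1 hℓn (1 - α)
  rw [mul_add, mul_div_assoc, mul_left_comm (m : ℝ) 2] at hstep
  have hy : 0 ≤ M / √((m : ℝ) + 2) := by positivity
  refine ⟨ℓ, hℓ1, hℓn, by linarith, ?_⟩
  set y := M / √((m : ℝ) + 2)
  have b2' := mul_le_mul_of_nonneg_left b2 (show (0 : ℝ) ≤ m + 1 by linarith)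
  nlinarith [mul_nonneg hy (show (0 : ℝ) ≤ m - 400 by linarith)]

theorem exists_mem_qqcFeasible (hα : α ∈ Ioo (0 : ℝ) 1) (hβ : β ∈ Ioo (0 : ℝ) 1)
    (hn : 100 ≤ n * ((1 - α) * α)) (hm : 400 * (max (2 * √(Real.log (1 / β))) 1) ^ 2 ≤ m) :
    ∃ q ∈ qqcFeasible n m α β,
      betaBetaQuantile n m q.1 q.2 (1 - β) ≤ coverageBound n m α β := by
  obtain ⟨ℓ, hℓ1, hℓn, hℓ, -⟩ := exists_order hα hβ hn hm
  have hm0 : (0 : ℝ) < m := by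
    have := le_max_right (2 * √(Real.log (1 / β))) 1
    nlinarith
  have hL : 0 < Real.log (1 / β) := Real.log_pos ((one_lt_div hβ.1).2 hβ.2)
  have hg : 0 < √(2 * m * Real.log (1 / β)) := Real.sqrt_pos.2 (by positivity)
  set g := √(2 * m * Real.log (1 / β)) with hgdef
  set F := orderStatCDF ℓ n (1 - α) with hF
  have hF0 : 0 ≤ F := orderStatCDF_nonneg _ _ _
  have hp1 := orderStatCDF_le_one hℓ1 hℓn (coverageBound n m α β)
  have hp0 := orderStatCDF_nonneg ℓ n (coverageBound n m α β)
  -- The least integer strictly above `m * F + g`: strictness yields feasibility through the upper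
  -- tail, and `k - 1 ≤ m * F + g` is what the lower tail needs.
  set k := ⌊m * F + g⌋₊ + 1 with hk
  have hk1 : 1 ≤ k := by omega
  have hkle : (k : ℝ) - 1 ≤ m * F + g := by
    rw [hk, Nat.cast_add_one, add_sub_cancel_right]
    exact Nat.floor_le (by positivity)
  have hklt : m * F + g < k := by
    rw [hk, Nat.cast_add_one]
    exact Nat.lt_floor_add_one _
  have hkm : k ≤ m := by
    have h1 : (k : ℝ) < m + 1 := by nlinarith
    have h2 : k < m + 1 := by exact_mod_cast h1
    omega
  refine ⟨(ℓ, k), ⟨⟨hℓ1, hℓn⟩, ⟨hk1, hkm⟩, ?_⟩, ?_⟩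
  · by_contra hcon
    have hu := (betaBetaQuantile_le_iff hℓ1 hℓn hk1 hkm hβ.1 hβ.2.le _).1 le_rfl
    have hmono : orderStatCDF ℓ n (betaBetaQuantile n m ℓ k β) ≤ F :=
      orderStatCDF_mono hℓ1 hℓn (not_le.1 hcon).le
    have hlt := orderStatCDF_lt hβ hk1 hkm (orderStatCDF_nonneg _ _ _)
      (orderStatCDF_le_one hℓ1 hℓn (betaBetaQuantile n m ℓ k β))
      (lt_of_le_of_lt (add_le_add_left (mul_le_mul_of_nonneg_left hmono hm0.le) _) hklt)
    linarith
  · rw [betaBetaQuantile_le_iff hℓ1 hℓn hk1 hkm (by linarith [hβ.2]) (by linarith [hβ.1])]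
    exact one_sub_le_orderStatCDF hβ hk1 hkm hp0 hp1 (by linarith)

theorem one_le_condOrder (hβ : β ∈ Ioo (0 : ℝ) 1) (ℓ : ℕ) : 1 ≤ condOrder m n ℓ α β := by
  have hL : 0 < Real.log (1 / β) := Real.log_pos ((one_lt_div hβ.1).2 hβ.2)
  refine Nat.one_le_ceil_iff.2 ?_
  have := orderStatCDF_nonneg ℓ n (1 - α)
  have : 0 < √(Real.log (1 / β) / (2 * ((m : ℝ) + 2))) := Real.sqrt_pos.2 (by positivity)
  positivity

theorem exists_mem_qqcFastFeasible (hα : α ∈ Ioo (0 : ℝ) 1) (hβ : β ∈ Ioo (0 : ℝ) 1)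
    (hn : 100 ≤ n * ((1 - α) * α)) (hm : 400 * (max (2 * √(Real.log (1 / β))) 1) ^ 2 ≤ m) :
    ∃ ℓ ∈ qqcFastFeasible n m α β,
      betaBetaQuantile n m ℓ (condOrder m n ℓ α β) (1 - β) ≤ coverageBound n m α β := by
  obtain ⟨ℓ, hℓ1, hℓn, -, hℓ⟩ := exists_order hα hβ hn hm
  have hg := Real.sqrt_nonneg (2 * m * Real.log (1 / β))
  have hF0 := orderStatCDF_nonneg ℓ n (1 - α)
  have hp1 := orderStatCDF_le_one hℓ1 hℓn (coverageBound n m α β)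
  have hp0 := orderStatCDF_nonneg ℓ n (coverageBound n m α β)
  have hm0 : (0 : ℝ) ≤ m := Nat.cast_nonneg m
  have hk1 : 1 ≤ condOrder m n ℓ α β := one_le_condOrder hβ ℓ
  have hkm : condOrder m n ℓ α β ≤ m := by
    refine Nat.ceil_le.2 ?_
    have := mul_le_mul_of_nonneg_left hp1 hm0
    linarith
  -- The rounding error below `1` is absorbed by the `k - 1` in the lower-tail bound.
  have hlt : (condOrder m n ℓ α β : ℝ) < ((m : ℝ) + 1) *
      (orderStatCDF ℓ n (1 - α) + √(Real.log (1 / β) / (2 * ((m : ℝ) + 2)))) + 1 :=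
    Nat.ceil_lt_add_one (by positivity)
  refine ⟨ℓ, ⟨⟨hℓ1, hℓn⟩, hkm⟩, ?_⟩
  rw [betaBetaQuantile_le_iff hℓ1 hℓn hk1 hkm (by linarith [hβ.2]) (by linarith [hβ.1])]
  exact one_sub_le_orderStatCDF hβ hk1 hkm hp0 hp1 (by linarith)

theorem qqcFeasible_finite : (qqcFeasible n m α β).Finite :=
  ((finite_Icc 1 n).prod (finite_Icc 1 m)).subset fun _ hp => ⟨hp.1, hp.2.1⟩

theorem qqcFastFeasible_finite : (qqcFastFeasible n m α β).Finite :=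
  (finite_Icc 1 n).subset fun _ hp => hp.1

theorem exists_isQQCChoice (h : (qqcFeasible n m α β).Nonempty) :
    ∃ p, IsQQCChoice n m α β p := by
  obtain ⟨p, hp, hmin⟩ := exists_min_image _
    (fun p : ℕ × ℕ => betaBetaQuantile n m p.1 p.2 (1 - β)) qqcFeasible_finite h
  exact ⟨p, hp, hmin⟩

theorem exists_isQQCFastChoice (h : (qqcFastFeasible n m α β).Nonempty) :
    ∃ p, IsQQCFastChoice n m α β p := by
  obtain ⟨ℓ, hℓ, hmin⟩ := exists_min_image _
    (fun ℓ : ℕ => betaBetaQuantile n m ℓ (condOrder m n ℓ α β) (1 - β)) qqcFastFeasible_finite h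
  exact ⟨(ℓ, condOrder m n ℓ α β), rfl, hℓ, hmin⟩

/-- The orders chosen by either algorithm have a small Beta-Beta quantile. -/
theorem choice_spec (hα : α ∈ Ioo (0 : ℝ) 1) (hβ : β ∈ Ioo (0 : ℝ) 1)
    (hn : 100 ≤ n * ((1 - α) * α)) (hm : 400 * (max (2 * √(Real.log (1 / β))) 1) ^ 2 ≤ m)
    {p : ℕ × ℕ} (hp : IsQQCChoice n m α β p ∨ IsQQCFastChoice n m α β p) :
    p.1 ∈ Icc 1 n ∧ p.2 ∈ Icc 1 m ∧
      1 - β ≤ orderStatCDF p.2 m (orderStatCDF p.1 n (coverageBound n m α β)) := by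
  have key : p.1 ∈ Icc 1 n ∧ p.2 ∈ Icc 1 m ∧
      betaBetaQuantile n m p.1 p.2 (1 - β) ≤ coverageBound n m α β := by
    rcases hp with ⟨hfeas, hmin⟩ | ⟨hk, hfeas, hmin⟩
    · obtain ⟨q, hq, hle⟩ := exists_mem_qqcFeasible hα hβ hn hm
      exact ⟨hfeas.1, hfeas.2.1, (hmin q hq).trans hle⟩
    · obtain ⟨ℓ, hℓ, hle⟩ := exists_mem_qqcFastFeasible hα hβ hn hm
      rw [hk]
      exact ⟨hfeas.1, ⟨one_le_condOrder hβ _, hfeas.2⟩, (hmin ℓ hℓ).trans hle⟩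
  refine ⟨key.1, key.2.1, ?_⟩
  exact (betaBetaQuantile_le_iff key.1.1 key.1.2 key.2.1.1 key.2.1.2 (by linarith [hβ.2])
    (by linarith [hβ.1]) _).1 key.2.2

end Choice

/-! ### Order statistics of independent variables -/

/-- Passing from order statistics to counts is what brings in binomial variables; the sorted index
is `r - 1` because `Fin N` starts at `0`. -/
theorem sampleQuantile_le_iff {N r : ℕ} (hr : 1 ≤ r) (hrN : r ≤ N) (v : Fin N → EReal)
    (x : EReal) : sampleQuantile r v ≤ x ↔ r ≤ (Finset.univ.filter fun i => v i ≤ x).card := by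
  have h : r - 1 < N := by omega
  rw [sampleQuantile, dif_pos h]
  have key := Tuple.lt_card_le_iff_apply_le_of_monotone (j := ⟨r - 1, h⟩) (a := x)
    (Tuple.monotone_sort v)
  have hcard : (Finset.univ.filter fun i => (v ∘ Tuple.sort v) i ≤ x).card =
      (Finset.univ.filter fun i => v i ≤ x).card :=
    Finset.card_equiv (Tuple.sort v) (by simp)
  rw [hcard] at key
  simp only [Function.comp_apply] at key
  rw [← key]
  omega

theorem qqEstimator_le_iff {m n ℓ k : ℕ} (hℓ : ℓ ∈ Icc 1 n) (hk : k ∈ Icc 1 m)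
    (S : Fin m → Fin n → ℝ) (x : ℝ) : qqEstimator ℓ k S ≤ x ↔
      k ≤ (Finset.univ.filter fun j =>
        ℓ ≤ (Finset.univ.filter fun i => S j i ≤ x).card).card := by
  rw [qqEstimator, sampleQuantile_le_iff hk.1 hk.2]
  simp only [sampleQuantile_le_iff hℓ.1 hℓ.2, EReal.coe_le_coe_iff]

theorem measurableSet_le_card_filter {Ω ι : Type*} [MeasurableSpace Ω] [Fintype ι]
    {p : ι → Ω → Prop} [∀ i, DecidablePred (p i)] (hp : ∀ i, MeasurableSet {ω | p i ω}) (r : ℕ) :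
    MeasurableSet {ω | r ≤ (Finset.univ.filter fun i => p i ω).card} := by
  simp only [Finset.card_filter]
  have : Measurable fun ω => ∑ i, if p i ω then 1 else 0 :=
    Finset.measurable_sum _ fun i _ => Measurable.ite (hp i) measurable_const measurable_const
  exact measurableSet_le measurable_const this

theorem measurable_sampleQuantile {Ω : Type*} [MeasurableSpace Ω] {N r : ℕ} (hr : 1 ≤ r)
    (hrN : r ≤ N) {v : Fin N → Ω → EReal} (hv : ∀ i, Measurable (v i)) :
    Measurable fun ω => sampleQuantile r fun i => v i ω := by
  refine measurable_of_Iic fun x => ?_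
  have : (fun ω => sampleQuantile r fun i => v i ω) ⁻¹' Iic x =
      {ω | r ≤ (Finset.univ.filter fun i => v i ω ≤ x).card} := by
    ext ω
    exact sampleQuantile_le_iff hr hrN _ x
  rw [this]
  exact measurableSet_le_card_filter (fun i => measurableSet_le (hv i) measurable_const) r

theorem measurable_qqEstimator {Ω : Type*} [MeasurableSpace Ω] {m n ℓ k : ℕ} (hℓ : ℓ ∈ Icc 1 n)
    (hk : k ∈ Icc 1 m) {S : Fin m → Fin n → Ω → ℝ} (hS : ∀ j i, Measurable (S j i)) :
    Measurable fun ω => qqEstimator ℓ k fun j i => S j i ω :=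
  measurable_sampleQuantile hk.1 hk.2 fun j =>
    measurable_sampleQuantile hℓ.1 hℓ.2 fun i => (hS j i).coe_real_ereal

open Classical in
/-- The number of successes in independent trials is binomial. -/
theorem measureReal_le_card_eq_binomialTail {Ω ι E : Type*} [MeasurableSpace Ω]
    [MeasurableSpace E] [Fintype ι] {P : Measure Ω} [IsProbabilityMeasure P] {X : ι → Ω → E}
    (hX : iIndepFun X P) (hm : ∀ i, Measurable (X i)) {A : Set E} (hA : MeasurableSet A) {p : ℝ}
    (hp : ∀ i, P.real (X i ⁻¹' A) = p) (r : ℕ) :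
    P.real {ω | r ≤ (Finset.univ.filter fun i => X i ω ∈ A).card} =
      binomialTail (Fintype.card ι) r p := by
  -- Decompose according to the exact set of successes. Its probability depends only on its
  -- cardinality, and grouping by cardinality creates the binomial coefficients.
  have hpattern : ∀ s : Finset ι, P.real {ω | (Finset.univ.filter fun i => X i ω ∈ A) = s} =
      p ^ s.card * (1 - p) ^ (Fintype.card ι - s.card) := by
    intro s
    have hset : {ω | (Finset.univ.filter fun i => X i ω ∈ A) = s} =
        ⋂ i ∈ Finset.univ, X i ⁻¹' (if i ∈ s then A else Aᶜ) := by
      ext ω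
      simp only [mem_ofPred_eq, Finset.mem_univ, iInter_true, mem_iInter, mem_preimage,
        Finset.ext_iff, Finset.mem_filter, true_and]
      refine forall_congr' fun i => ?_
      by_cases hi : i ∈ s <;> simp [hi]
    have hind := (iIndepFun_iff_measure_inter_preimage_eq_mul.1 hX) Finset.univ
      (sets := fun i => if i ∈ s then A else Aᶜ) (fun i _ => by
        by_cases hi : i ∈ s <;> simp [hi, hA, hA.compl])
    rw [hset, measureReal_def, hind, ENNReal.toReal_prod]
    have hterm : ∀ i, (P (X i ⁻¹' (if i ∈ s then A else Aᶜ))).toReal =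
        if i ∈ s then p else 1 - p := by
      intro i
      by_cases hi : i ∈ s
      · simp only [hi, if_true]
        exact hp i
      · simp only [hi, if_false]
        rw [preimage_compl, ← measureReal_def, probReal_compl_eq_one_sub (hm i hA), hp i]
    rw [Finset.prod_congr rfl fun i _ => hterm i, Finset.prod_ite, Finset.prod_const,
      Finset.prod_const, Finset.filter_mem_eq_inter, Finset.univ_inter]
    congr 2
    rw [Finset.filter_not, Finset.filter_mem_eq_inter, Finset.univ_inter,
      Finset.card_sdiff_of_subset (Finset.subset_univ s), Finset.card_univ]
  have hunion : {ω | r ≤ (Finset.univ.filter fun i => X i ω ∈ A).card} =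
      ⋃ s ∈ (Finset.univ : Finset ι).powerset.filter (fun s => r ≤ s.card),
        {ω | (Finset.univ.filter fun i => X i ω ∈ A) = s} := by
    ext ω
    simp
  have hmeas : ∀ s : Finset ι, MeasurableSet {ω | (Finset.univ.filter fun i => X i ω ∈ A) = s} := by
    intro s
    have : {ω | (Finset.univ.filter fun i => X i ω ∈ A) = s} =
        ⋂ i, {ω | X i ω ∈ A ↔ i ∈ s} := by
      ext ω
      simp [Finset.ext_iff]
    rw [this]
    refine MeasurableSet.iInter fun i => ?_
    by_cases hi : i ∈ s
    · have : {ω | X i ω ∈ A ↔ i ∈ s} = X i ⁻¹' A := by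
        ext ω
        simp [hi]
      exact this ▸ hm i hA
    · have : {ω | X i ω ∈ A ↔ i ∈ s} = (X i ⁻¹' A)ᶜ := by
        ext ω
        simp [hi]
      exact this ▸ (hm i hA).compl
  rw [hunion, measureReal_biUnion_finset ?_ fun s _ => hmeas s]
  · rw [Finset.sum_congr rfl fun s _ => hpattern s, Finset.sum_filter,
      Finset.sum_powerset_apply_card
        (fun j => if r ≤ j then p ^ j * (1 - p) ^ (Fintype.card ι - j) else 0),
      Finset.card_univ, binomialTail]
    have hIcc : Finset.Icc r (Fintype.card ι) =
        (Finset.range (Fintype.card ι + 1)).filter (fun j => r ≤ j) := by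
      ext j
      simp only [Finset.mem_Icc, Finset.mem_filter, Finset.mem_range]
      omega
    rw [hIcc, Finset.sum_filter]
    refine Finset.sum_congr rfl fun j _ => ?_
    by_cases hj : r ≤ j
    · simp [hj, eval_bernstein, mul_assoc]
    · simp [hj]
  · intro s _ s' _ hss'
    exact Set.disjoint_left.2 fun ω h1 h2 => hss' (h1.symm.trans h2)

/-- The rows of an independent array are independent. -/
theorem iIndepFun_curry {Ω ι κ E : Type*} [MeasurableSpace Ω] [MeasurableSpace E] [Countable ι]
    [Countable κ] {P : Measure Ω} {X : ι → κ → Ω → E} (hm : ∀ i j, Measurable (X i j))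
    (hX : iIndepFun (fun q : ι × κ => X q.1 q.2) P) : iIndepFun (fun i ω j => X i j ω) P := by
  have := hX.isProbabilityMeasure
  have hprob : ∀ i j, IsProbabilityMeasure (P.map (X i j)) := fun i j =>
    Measure.isProbabilityMeasure_map (hm i j).aemeasurable
  have hrow : ∀ i, iIndepFun (X i) P := fun i =>
    hX.precomp (g := fun j : κ => (i, j)) fun _ _ h => (Prod.mk.inj h).2
  -- Reindexing by dependent pairs lets `piCurry` turn the product law of the array into the product
  -- of the laws of its rows.
  have hsig : iIndepFun (fun (q : (_ : ι) × κ) ω => X q.1 q.2 ω) P :=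
    hX.precomp (g := Equiv.sigmaEquivProd ι κ) (Equiv.sigmaEquivProd ι κ).injective
  rw [iIndepFun_iff_map_fun_eq_infinitePi_map (by fun_prop)] at hsig ⊢
  have h1 : (MeasurableEquiv.piCurry fun (_ : ι) (_ : κ) => E) ∘ (fun ω p => X p.1 p.2 ω) =
      fun ω i j => X i j ω := by
    ext
    simp [Sigma.curry]
  rw [← h1, ← Measure.map_map (by fun_prop) (by fun_prop), hsig,
    Measure.infinitePi_map_piCurry (fun i j => P.map (X i j))]
  congr 1
  funext i
  rw [(iIndepFun_iff_map_fun_eq_infinitePi_map (by fun_prop)).1 (hrow i)]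

/-- The distribution of the quantile-of-quantiles of independent variables. -/
theorem measureReal_qqEstimator_le {Ω : Type*} [MeasurableSpace Ω] {P : Measure Ω}
    [IsProbabilityMeasure P] {m n ℓ k : ℕ} (hℓ : ℓ ∈ Icc 1 n) (hk : k ∈ Icc 1 m)
    {V : Fin m → Fin n → Ω → ℝ} (hV : ∀ j i, Measurable (V j i))
    (hind : iIndepFun (fun q : Fin m × Fin n => V q.1 q.2) P) {x p : ℝ}
    (hp : ∀ j i, P.real (V j i ⁻¹' Iic x) = p) :
    P.real {ω | qqEstimator ℓ k (fun j i => V j i ω) ≤ x} =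
      binomialTail m k (binomialTail n ℓ p) := by
  have hrow : ∀ j, iIndepFun (V j) P := fun j =>
    hind.precomp (g := fun i : Fin n => (j, i)) fun _ _ h => (Prod.mk.inj h).2
  have hA : MeasurableSet {z : Fin n → ℝ | ℓ ≤ (Finset.univ.filter fun i => z i ≤ x).card} :=
    measurableSet_le_card_filter
      (fun i => measurableSet_le (measurable_pi_apply i) measurable_const) ℓ
  have hagent : ∀ j, P.real ((fun ω i => V j i ω) ⁻¹'
      {z : Fin n → ℝ | ℓ ≤ (Finset.univ.filter fun i => z i ≤ x).card}) = binomialTail n ℓ p := by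
    intro j
    have := measureReal_le_card_eq_binomialTail (hrow j) (hV j) measurableSet_Iic (hp j) ℓ
    rw [Fintype.card_fin] at this
    rw [← this]
    congr 1
  have := measureReal_le_card_eq_binomialTail (iIndepFun_curry hV hind)
    (fun j => measurable_pi_lambda _ fun i => hV j i) hA hagent k
  rw [Fintype.card_fin] at this
  rw [← this]
  congr 1
  ext ω
  rw [mem_ofPred_eq, qqEstimator_le_iff hℓ hk]
  simp only [mem_ofPred_eq]

theorem continuous_cdf_of_noAtoms (ν : Measure ℝ) [IsProbabilityMeasure ν]
    (hν : ∀ x, ν {x} = 0) : Continuous (cdf ν) := by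
  rw [continuous_iff_continuousAt]
  intro x
  rw [(monotone_cdf ν).continuousAt_iff_leftLim_eq_rightLim, StieltjesFunction.rightLim_eq]
  refine le_antisymm ((monotone_cdf ν).leftLim_le le_rfl) ?_
  have h := StieltjesFunction.measure_singleton (cdf ν) x
  rw [measure_cdf, hν x, eq_comm, ENNReal.ofReal_eq_zero] at h
  linarith

theorem exists_measureReal_Iic_eq (ν : Measure ℝ) [IsProbabilityMeasure ν] (hν : ∀ x, ν {x} = 0)
    {t : ℝ} (ht : t ∈ Ioo (0 : ℝ) 1) : ∃ x, ν.real (Iic x) = t := by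
  have h0 : ∃ a, cdf ν a ≤ t :=
    ((tendsto_cdf_atBot ν).eventually_lt_const ht.1).exists.imp fun _ h => h.le
  have h1 : ∃ b, t ≤ cdf ν b :=
    ((tendsto_cdf_atTop ν).eventually_const_lt ht.2).exists.imp fun _ h => h.le
  obtain ⟨x, hx⟩ := mem_range_of_exists_le_of_exists_ge (continuous_cdf_of_noAtoms ν hν) h0 h1
  exact ⟨x, by rw [← cdf_eq_real, hx]⟩

/-- The coverage of the half-line below the quantile-of-quantiles is stochastically dominated by
the Beta-Beta distribution. -/
theorem le_measureReal_coverage_le {Ω : Type*} [MeasurableSpace Ω] {P : Measure Ω}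
    [IsProbabilityMeasure P] {m n ℓ k : ℕ} (hℓ : ℓ ∈ Icc 1 n) (hk : k ∈ Icc 1 m)
    {V : Fin m → Fin n → Ω → ℝ} (hV : ∀ j i, Measurable (V j i))
    (hind : iIndepFun (fun q : Fin m × Fin n => V q.1 q.2) P)
    {ν : Measure ℝ} [IsProbabilityMeasure ν] (hlaw : ∀ j i, P.map (V j i) = ν)
    (hν : ∀ x, ν {x} = 0) {t : ℝ} (ht : 0 < t) :
    orderStatCDF k m (orderStatCDF ℓ n t) ≤
      P.real {ω | ν.real {y : ℝ | (y : EReal) ≤ qqEstimator ℓ k (fun j i => V j i ω)} ≤ t} := by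
  rcases le_or_gt 1 t with ht1 | ht1
  · have : {ω | ν.real {y : ℝ | (y : EReal) ≤ qqEstimator ℓ k (fun j i => V j i ω)} ≤ t} =
        univ := eq_univ_of_forall fun ω => measureReal_le_one.trans ht1
    rw [this, probReal_univ]
    exact orderStatCDF_le_one hk.1 hk.2 _
  -- Absence of atoms gives an exact level `x`. Only the inclusion of `S_(ℓ,k) ≤ x` in the coverage
  -- event is needed, hence an inequality.
  · obtain ⟨x, hx⟩ := exists_measureReal_Iic_eq ν hν ⟨ht, ht1⟩
    rw [orderStatCDF_eq_binomialTail hk.1 hk.2 (orderStatCDF_nonneg _ _ _)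
      (orderStatCDF_le_one hℓ.1 hℓ.2 t), orderStatCDF_eq_binomialTail hℓ.1 hℓ.2 ht.le ht1.le,
      ← measureReal_qqEstimator_le hℓ hk hV hind (x := x) (p := t) fun j i => by
        rw [← hx, ← hlaw j i, map_measureReal_apply (hV j i) measurableSet_Iic]]
    refine measureReal_mono fun ω hω => ?_
    rw [mem_ofPred_eq] at hω ⊢
    rw [← hx]
    exact measureReal_mono fun y hy => EReal.coe_le_coe_iff.1 (le_trans hy hω)

/-! ### Conditioning on one of two independent variables -/

/-- If `Y` is independent of `X`, a conditional probability given `X` is obtained by freezing `X`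
and integrating out `Y`. -/
theorem condExp_indicator_of_indepFun {Ω A B : Type*} [MeasurableSpace Ω] [mA : MeasurableSpace A]
    [MeasurableSpace B] {P : Measure Ω} [IsProbabilityMeasure P] {X : Ω → A} {Y : Ω → B}
    (hX : Measurable X) (hY : Measurable Y) (hXY : IndepFun X Y P) {S : Set (A × B)}
    (hS : MeasurableSet S) :
    P⟦{ω | (X ω, Y ω) ∈ S} | MeasurableSpace.comap X mA⟧ =ᵐ[P]
      fun ω => (P.map Y).real (Prod.mk (X ω) ⁻¹' S) := by
  have hμX : IsProbabilityMeasure (P.map X) := Measure.isProbabilityMeasure_map hX.aemeasurable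
  have hμY : IsProbabilityMeasure (P.map Y) := Measure.isProbabilityMeasure_map hY.aemeasurable
  have hg : Measurable fun a => (P.map Y).real (Prod.mk a ⁻¹' S) :=
    (measurable_measure_prodMk_left hS).ennreal_toReal
  have hgint : Integrable (fun ω => (P.map Y).real (Prod.mk (X ω) ⁻¹' S)) P :=
    Integrable.of_bound (hg.comp hX).aestronglyMeasurable 1
      (Filter.Eventually.of_forall fun ω => by
        rw [Real.norm_of_nonneg measureReal_nonneg]
        exact measureReal_le_one)
  have hE : MeasurableSet {ω | (X ω, Y ω) ∈ S} := (hX.prodMk hY) hS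
  refine (ae_eq_condExp_of_forall_setIntegral_eq hX.comap_le
    ((integrable_const (1 : ℝ)).indicator hE) (fun s _ _ => hgint.integrableOn) ?_ ?_).symm
  · rintro _ ⟨t, ht, rfl⟩ -
    rw [setIntegral_indicator hE, setIntegral_const, smul_eq_mul, mul_one,
      ← setIntegral_map ht hg.aestronglyMeasurable hX.aemeasurable]
    have hset : X ⁻¹' t ∩ {ω | (X ω, Y ω) ∈ S} =
        (fun ω => (X ω, Y ω)) ⁻¹' (S ∩ t ×ˢ univ) := by
      ext ω
      simp [and_comm]
    have hSt : MeasurableSet (S ∩ t ×ˢ (univ : Set B)) := hS.inter (ht.prod MeasurableSet.univ)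
    rw [hset, ← map_measureReal_apply (hX.prodMk hY) hSt,
      (indepFun_iff_map_prod_eq_prod_map_map hX.aemeasurable hY.aemeasurable).1 hXY,
      measureReal_def, Measure.prod_apply hSt, ← integral_toReal
        (measurable_measure_prodMk_left hSt).aemeasurable
        (Filter.Eventually.of_forall fun _ => measure_lt_top _ _), ← integral_indicator ht]
    congr 1
    ext a
    by_cases ha : a ∈ t
    · rw [indicator_of_mem ha, measureReal_def]
      congr 2
      ext b
      simp [ha]
    · rw [indicator_of_notMem ha]
      have : Prod.mk a ⁻¹' (S ∩ t ×ˢ (univ : Set B)) = ∅ := by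
        ext b
        simp [ha]
      simp [this]
  · exact (hg.comp (comap_measurable X)).aestronglyMeasurable

/-- If the scores of two independent points are almost surely distinct, then the conditional
distribution of the scores has almost surely no atom. -/
theorem ae_measure_singleton_eq_zero {Ω Λ E : Type*} [MeasurableSpace Ω] [MeasurableSpace Λ]
    [MeasurableSpace E] {P : Measure Ω} [IsProbabilityMeasure P] {s : Λ → E → ℝ} {L : Ω → Λ}
    {W Z₀ : Ω → E} (hs : Measurable fun q : Λ × E => s q.1 q.2) (hL : Measurable L)
    (hW : Measurable W) (hZ₀ : Measurable Z₀) (hlaw : P.map W = P.map Z₀) (hLW : IndepFun L W P)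
    (hind : IndepFun Z₀ (fun ω => (L ω, W ω)) P)
    (hne : ∀ᵐ ω ∂P, s (L ω) (W ω) ≠ s (L ω) (Z₀ ω)) :
    ∀ᵐ ω ∂P, ∀ x, (P.map Z₀).map (s (L ω)) {x} = 0 := by
  have hprob : IsProbabilityMeasure (P.map Z₀) :=
    Measure.isProbabilityMeasure_map hZ₀.aemeasurable
  have hprobL : IsProbabilityMeasure (P.map L) := Measure.isProbabilityMeasure_map hL.aemeasurable
  set T : Set ((Λ × E) × E) := {q | s q.1.1 q.1.2 = s q.1.1 q.2} with hT
  have hTm : MeasurableSet T := measurableSet_eq_fun (hs.comp measurable_fst)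
    (hs.comp ((measurable_fst.comp measurable_fst).prodMk measurable_snd))
  have hLWm : Measurable fun ω => (L ω, W ω) := hL.prodMk hW
  have hzero : ((P.map L).prod (P.map Z₀)).prod (P.map Z₀) T = 0 := by
    rw [← hlaw, ← (indepFun_iff_map_prod_eq_prod_map_map hL.aemeasurable hW.aemeasurable).1 hLW,
      hlaw, ← (indepFun_iff_map_prod_eq_prod_map_map hLWm.aemeasurable hZ₀.aemeasurable).1
        hind.symm, Measure.map_apply (hLWm.prodMk hZ₀) hTm]
    refine measure_mono_null (fun ω hω => ?_) (ae_iff.1 hne)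
    exact not_not.2 hω
  have h1 := Measure.ae_ae_of_ae_prod (Measure.measure_ae_null_of_prod_null hzero)
  filter_upwards [ae_of_ae_map hL.aemeasurable h1] with ω hω x
  have hsm : Measurable (s (L ω)) := hs.comp measurable_prodMk_left
  rw [Measure.map_apply hsm (measurableSet_singleton x)]
  -- If `x` were an atom, every `w` with score `x` would tie with a set of positive mass, so all
  -- these `w` would lie in the null exceptional set: a contradiction.
  by_contra hx
  refine hx (measure_mono_null ?_ (ae_iff.1 hω))
  intro w hw hcon
  refine hx ?_
  have : Prod.mk (L ω, w) ⁻¹' T = s (L ω) ⁻¹' {x} := by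
    ext z
    have hw' : s (L ω) w = x := hw
    simp only [hT, mem_preimage, mem_ofPred_eq, hw', mem_singleton_iff]
    exact eq_comm
  rw [← this]
  exact hcon

/-! ### Training-conditional coverage -/

section Coverage

variable {Ω Λ 𝒳 𝒴 : Type*} [MeasurableSpace Ω] [MeasurableSpace Λ] [MeasurableSpace 𝒳]
  [MeasurableSpace 𝒴] {m n ℓ k : ℕ}

theorem measurableSet_score_le_qqEstimator (hℓ : ℓ ∈ Icc 1 n) (hk : k ∈ Icc 1 m)
    {s : Λ → 𝒳 × 𝒴 → ℝ} (hs : Measurable fun q : Λ × (𝒳 × 𝒴) => s q.1 q.2) :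
    MeasurableSet {q : (Λ × (Fin m → Fin n → 𝒳 × 𝒴)) × (𝒳 × 𝒴) |
      (s q.1.1 q.2 : EReal) ≤ qqEstimator ℓ k fun j i => s q.1.1 (q.1.2 j i)} := by
  refine measurableSet_le
    (hs.comp ((measurable_fst.comp measurable_fst).prodMk measurable_snd)).coe_real_ereal
    (measurable_qqEstimator hℓ hk fun j i => ?_)
  have : Measurable fun q : (Λ × (Fin m → Fin n → 𝒳 × 𝒴)) × (𝒳 × 𝒴) => (q.1.1, q.1.2 j i) := by
    fun_prop
  exact hs.comp this

theorem one_sub_qqMiscoverage_ae_eq {P : Measure Ω} [IsProbabilityMeasure P] (hℓ : ℓ ∈ Icc 1 n)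
    (hk : k ∈ Icc 1 m) {s : Λ → 𝒳 × 𝒴 → ℝ} {L : Ω → Λ} {Z : Fin m → Fin n → Ω → 𝒳 × 𝒴}
    {Z₀ : Ω → 𝒳 × 𝒴} (hs : Measurable fun q : Λ × (𝒳 × 𝒴) => s q.1 q.2) (hL : Measurable L)
    (hZ : ∀ j i, Measurable (Z j i)) (hZ₀ : Measurable Z₀)
    (hind : IndepFun Z₀ (fun ω => (L ω, fun j i => Z j i ω)) P) :
    (fun ω => 1 - qqMiscoverage P s L Z Z₀ ℓ k ω) =ᵐ[P] fun ω =>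
      (P.map Z₀).real {z | (s (L ω) z : EReal) ≤ qqEstimator ℓ k fun j i => s (L ω) (Z j i ω)} := by
  have hprob : IsProbabilityMeasure (P.map Z₀) :=
    Measure.isProbabilityMeasure_map hZ₀.aemeasurable
  have hZm : Measurable fun ω j i => Z j i ω :=
    measurable_pi_lambda _ fun j => measurable_pi_lambda _ fun i => hZ j i
  have hS := measurableSet_score_le_qqEstimator hℓ hk hs
  filter_upwards [condExp_indicator_of_indepFun (hL.prodMk hZm) hZ₀ hind.symm hS.compl] with ω hω
  have hsec := measurable_prodMk_left (x := (L ω, fun j i => Z j i ω)) hS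
  rw [preimage_compl, probReal_compl_eq_one_sub hsec] at hω
  have hω' : qqMiscoverage P s L Z Z₀ ℓ k ω = 1 - (P.map Z₀).real
      {z | (s (L ω) z : EReal) ≤ qqEstimator ℓ k fun j i => s (L ω) (Z j i ω)} := hω
  rw [hω', sub_sub_cancel]

/-- The training-conditional coverage given the learning set. -/
theorem ae_le_condExp_coverage_le {P : Measure Ω} [IsProbabilityMeasure P] (hℓ : ℓ ∈ Icc 1 n)
    (hk : k ∈ Icc 1 m) {s : Λ → 𝒳 × 𝒴 → ℝ} {L : Ω → Λ} {Z : Fin m → Fin n → Ω → 𝒳 × 𝒴}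
    {Z₀ : Ω → 𝒳 × 𝒴} (hs : Measurable fun q : Λ × (𝒳 × 𝒴) => s q.1 q.2) (hL : Measurable L)
    (hZ : ∀ j i, Measurable (Z j i)) (hZ₀ : Measurable Z₀)
    (hiid : iIndepFun (fun (q : Fin m × Fin n) => Z q.1 q.2) P)
    (hlaw : ∀ j i, IdentDistrib (Z j i) Z₀ P P) (hLZ : IndepFun L (fun ω j i => Z j i ω) P)
    (hind : IndepFun Z₀ (fun ω => (L ω, fun j i => Z j i ω)) P)
    (hne : ∀ᵐ ω ∂P, ∀ j i, s (L ω) (Z j i ω) ≠ s (L ω) (Z₀ ω)) {t : ℝ} (ht : 0 < t) :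
    ∀ᵐ ω ∂P, orderStatCDF k m (orderStatCDF ℓ n t) ≤
      (P⟦{ω' | 1 - qqMiscoverage P s L Z Z₀ ℓ k ω' ≤ t} |
        MeasurableSpace.comap L inferInstance⟧) ω := by
  have hprob : IsProbabilityMeasure (P.map Z₀) :=
    Measure.isProbabilityMeasure_map hZ₀.aemeasurable
  have hZm : Measurable fun ω j i => Z j i ω :=
    measurable_pi_lambda _ fun j => measurable_pi_lambda _ fun i => hZ j i
  have hS := measurableSet_score_le_qqEstimator (ℓ := ℓ) (k := k) hℓ hk hs
  set T : Set (Λ × (Fin m → Fin n → 𝒳 × 𝒴)) := {q | (P.map Z₀).real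
    {z | (s q.1 z : EReal) ≤ qqEstimator ℓ k fun j i => s q.1 (q.2 j i)} ≤ t} with hT
  have hTm : MeasurableSet T :=
    measurableSet_le (measurable_measure_prodMk_left hS).ennreal_toReal measurable_const
  -- The miscoverage is only an almost-everywhere class. Replacing it by its explicit version makes
  -- the event a function of `(L, Z)`, so that `L` can be frozen in turn.
  have hcongr : P⟦{ω' | 1 - qqMiscoverage P s L Z Z₀ ℓ k ω' ≤ t} |
      MeasurableSpace.comap L inferInstance⟧ =ᵐ[P]
      P⟦{ω' | (L ω', fun j i => Z j i ω') ∈ T} | MeasurableSpace.comap L inferInstance⟧ := by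
    refine condExp_congr_ae (indicator_ae_eq_of_ae_eq_set ?_)
    filter_upwards [one_sub_qqMiscoverage_ae_eq hℓ hk hs hL hZ hZ₀ hind] with ω hω
    exact propext (by
      change 1 - qqMiscoverage P s L Z Z₀ ℓ k ω ≤ t ↔ _
      rw [hω]
      rfl)
  obtain ⟨j₀⟩ : Nonempty (Fin m) := ⟨0, hk.1.trans hk.2⟩
  obtain ⟨i₀⟩ : Nonempty (Fin n) := ⟨0, hℓ.1.trans hℓ.2⟩
  have hproj : Measurable fun z : Fin m → Fin n → 𝒳 × 𝒴 => z j₀ i₀ := by fun_prop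
  have hatoms := ae_measure_singleton_eq_zero hs hL (hZ j₀ i₀) hZ₀ (hlaw j₀ i₀).map_eq
    (hLZ.comp measurable_id hproj)
    (hind.comp measurable_id (measurable_fst.prodMk (hproj.comp measurable_snd)))
    (hne.mono fun ω h => h j₀ i₀)
  filter_upwards [hcongr, condExp_indicator_of_indepFun hL hZm hLZ hTm, hatoms] with ω h1 h2 h3
  rw [h1, h2, map_measureReal_apply hZm (measurable_prodMk_left hTm)]
  have hsm : Measurable (s (L ω)) := hs.comp measurable_prodMk_left
  have hν : IsProbabilityMeasure ((P.map Z₀).map (s (L ω))) :=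
    Measure.isProbabilityMeasure_map hsm.aemeasurable
  refine (le_measureReal_coverage_le hℓ hk (V := fun j i ω' => s (L ω) (Z j i ω'))
    (fun j i => hsm.comp (hZ j i)) (hiid.comp (fun _ => s (L ω)) fun _ => hsm)
    (ν := (P.map Z₀).map (s (L ω))) (fun j i => ?_) h3 ht).trans_eq ?_
  · rw [← (hlaw j i).map_eq, Measure.map_map hsm (hZ j i)]
    rfl
  · congr 1
    ext ω'
    have hmeas : MeasurableSet {y : ℝ | (y : EReal) ≤
        qqEstimator ℓ k fun j i => s (L ω) (Z j i ω')} :=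
      measurableSet_le measurable_coe_real_ereal measurable_const
    rw [mem_ofPred_eq, map_measureReal_apply hsm hmeas]
    rfl

end Coverage

/-! ### The main theorem -/

theorem mainTheorem3 :
    ∃ n₀ m₀ : ℝ → ℕ, (∀ α, 1 ≤ n₀ α) ∧ (∀ β, 1 ≤ m₀ β) ∧
      ∀ α ∈ Ioo (0 : ℝ) 1, ∀ β ∈ Ioo (0 : ℝ) 1, ∀ n m : ℕ, n₀ α ≤ n → m₀ β ≤ m →
        -- both algorithms return a pair
        (∃ p, IsQQCChoice n m α β p) ∧ (∃ p, IsQQCFastChoice n m α β p) ∧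
        -- and every pair that they may return satisfies the bound
        ∀ p : ℕ × ℕ, IsQQCChoice n m α β p ∨ IsQQCFastChoice n m α β p →
          ∀ (Ω Λ 𝒳 𝒴 : Type*) [MeasurableSpace Ω] [MeasurableSpace Λ]
            [MeasurableSpace 𝒳] [MeasurableSpace 𝒴]
            (P : Measure Ω) [IsProbabilityMeasure P]
            (s : Λ → 𝒳 × 𝒴 → ℝ) (L : Ω → Λ)
            (Z : Fin m → Fin n → Ω → 𝒳 × 𝒴) (Z₀ : Ω → 𝒳 × 𝒴),
            Measurable (fun q : Λ × (𝒳 × 𝒴) => s q.1 q.2) →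
            Measurable L → (∀ j i, Measurable (Z j i)) → Measurable Z₀ →
            -- the calibration data are i.i.d. and distributed as the test point
            iIndepFun (fun (q : Fin m × Fin n) => Z q.1 q.2) P →
            (∀ j i, IdentDistrib (Z j i) Z₀ P P) →
            -- the learning set is independent of the calibration data
            IndepFun L (fun ω j i => Z j i ω) P →
            -- the test point is independent of the whole data set
            IndepFun Z₀ (fun ω => (L ω, fun j i => Z j i ω)) P →
            -- the calibration scores and the test score are almost surely distinct
            (∀ᵐ ω ∂P,
              Function.Injective (fun q : Fin m × Fin n => s (L ω) (Z q.1 q.2 ω)) ∧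
              ∀ j i, s (L ω) (Z j i ω) ≠ s (L ω) (Z₀ ω)) →
            ∀ᵐ ω ∂P, 1 - β ≤
              (P⟦{ω' | 1 - qqMiscoverage P s L Z Z₀ p.1 p.2 ω' ≤
                    1 - α + coverageDelta β / √(((m : ℝ) + 2) * ((n : ℝ) + 2))} |
                MeasurableSpace.comap L inferInstance⟧) ω := by
  -- The thresholds encode `n (1 - α) α ≥ 100` and `m ≥ 400 * M²` with `M = max (2 √(log (1/β))) 1`;
  -- the added `1` makes them positive for every argument.
  refine ⟨fun α => ⌈100 / ((1 - α) * α)⌉₊ + 1,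
    fun β => ⌈400 * (max (2 * √(Real.log (1 / β))) 1) ^ 2⌉₊ + 1,
    fun _ => Nat.le_add_left _ _, fun _ => Nat.le_add_left _ _, ?_⟩
  intro α hα β hβ n m hn hm
  have hv : 0 < (1 - α) * α := mul_pos (by linarith [hα.2]) hα.1
  have hn' : 100 ≤ n * ((1 - α) * α) := by
    rw [← div_le_iff₀ hv]
    exact Nat.ceil_le.1 ((Nat.le_succ _).trans hn)
  have hm' : 400 * (max (2 * √(Real.log (1 / β))) 1) ^ 2 ≤ m :=
    Nat.ceil_le.1 ((Nat.le_succ _).trans hm)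
  obtain ⟨q, hq, -⟩ := exists_mem_qqcFeasible hα hβ hn' hm'
  obtain ⟨ℓ, hℓ, -⟩ := exists_mem_qqcFastFeasible hα hβ hn' hm'
  refine ⟨exists_isQQCChoice ⟨q, hq⟩, exists_isQQCFastChoice ⟨ℓ, hℓ⟩, ?_⟩
  intro p hp Ω Λ 𝒳 𝒴 _ _ _ _ P _ s L Z Z₀ hs hL hZ hZ₀ hiid hlaw hLZ hind hne
  obtain ⟨hp1, hp2, hle⟩ := choice_spec hα hβ hn' hm' hp
  have ht : 0 < coverageBound n m α β := by
    have : 0 ≤ coverageDelta β :=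
      mul_nonneg (by norm_num) (zero_le_one.trans (le_max_right _ _))
    have h2 : 0 ≤ coverageDelta β / √(((m : ℝ) + 2) * ((n : ℝ) + 2)) := by positivity
    rw [coverageBound]
    linarith [hα.2]
  filter_upwards [ae_le_condExp_coverage_le hp1 hp2 hs hL hZ hZ₀ hiid hlaw hLZ hind
    (hne.mono fun _ h => h.2) ht] with ω hω
  exact hle.trans hω
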